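/- Let $(X_n)_{n\ge 0}$ be a time-homogeneous Markov chain on a discrete state space $M$, with transition probabilities $P$. Write $\mathbb P_x,\mathbb E_x$ for probability and expectation when $X_0=x$. For $x\in M$ let $T(x)=\inf\{n\ge 0: X_n=x\}$, and for a finite nonempty set $A\subset M$ put $$T_{cov}(A)=\max_{x\in A}T(x),\qquad \mathrm{cov}_-(A)=\min_{x\in A}\mathbb E_x T_{cov}(A).$$ Let $d(x,y)=\mathbb E_xT(y)+\mathbb E_yT(x)$ be the commute distance and $\Delta(B,d)=\sup_{x,y\in B}d(x,y)$. Let $N_0=1$ and $N_n=2^{2^n}$ for $n\ge1$. A sequence $(\mathcal A_n)_{n\ge0}$ of partitions of $A$ is admissible if $\mathcal A_{n+1}$ refines $\mathcal A_n$ and $|\mathcal A_n|\le N_n$ for all $n\ge 0$; let $A_n(x)$ be the element of $\mathcal A_n$ containing $x$, and set $$\gamma_1(A,d)=\inf_{(\mathcal A_n)\ \text{admissible}}\ \sup_{x\in A}\ \sum_{n=0}^{\infty}2^n\,\Delta(A_n(x),d).$$ **Proposition.** (a) There is a universal constant $L$ such that, for every irreducible, positive recurrent chain that is reversible (i.e.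 some probability distribution $\pi$ on $M$ satisfies $\pi(x)P(x,y)=\pi(y)P(y,x)$ for all $x,y\in M$), and for every finite nonempty $A\subset M$, $$\gamma_1(A,d)\le L\bigl(\mathrm{cov}_-(A)+\Delta(A,d)\bigr).$$ (b) The term $\Delta(A,d)$ cannot be removed. For $0<\varepsilon<1$ let $M=\{0,1\}$ with transition matrix $$\begin{pmatrix}\varepsilon&1-\varepsilon\\ \varepsilon&1-\varepsilon\end{pmatrix}.$$ This chain is irreducible, positive recurrent and reversible, and $$\gamma_1(M,d)\ge\Delta(M,d)=\frac1{\varepsilon(1-\varepsilon)},\qquad \mathrm{cov}_-(M)=\min\Bigl(\frac1\varepsilon,\frac1{1-\varepsilon}\Bigr).$$ In particular, for every $L\ge 0$ there is $\varepsilon\in(0,1)$ such that, for this chain, $\gamma_1(M,d)>L\,\mathrm{cov}_-(M)$. -/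

import Mathlib

open MeasureTheory ProbabilityTheory
open scoped ENNReal NNReal

universe u

noncomputable section

namespace CoverTime

section Chain

variable {M : Type u} [MeasurableSpace M] [DiscreteMeasurableSpace M]

/-- The one-step kernel of the chain whose transition probabilities are `P x y`. -/
def stepKernel (P : M → PMF M) : Kernel M M where
  toFun x := (P x).toMeasure
  measurable' := Measurable.of_discrete

/-- Given the trajectory up to time `n`, the next state is chosen according to the transition
probabilities from the state at time `n`. -/
def historyKernel (P : M → PMF M) (n : ℕ) : Kernel (Finset.Iic n → M) M :=
  (stepKernel P).comap (fun h => h ⟨n, Finset.mem_Iic.2 le_rfl⟩) (measurable_pi_apply _)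

instance isMarkovKernel_historyKernel (P : M → PMF M) (n : ℕ) :
    IsMarkovKernel (historyKernel P n) where
  isProbabilityMeasure h :=
    inferInstanceAs (IsProbabilityMeasure (P (h ⟨n, Finset.mem_Iic.2 le_rfl⟩)).toMeasure)

/-- The law `ℙ_x`, on the space of trajectories `ω = (X_0, X_1, …)`, of the Markov chain with
transition probabilities `P` started at `x`. -/
def pathLaw (P : M → PMF M) (x : M) : Measure (ℕ → M) :=
  Kernel.traj (X := fun _ => M) (historyKernel P) 0 (fun _ => x)

/-- The hitting time `T(x) = inf {n ≥ 0 : X_n = x}`, equal to `∞` if `x` is never visited. -/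
def hitTime (x : M) (ω : ℕ → M) : ℝ≥0∞ :=
  ⨅ (n : ℕ) (_ : ω n = x), (n : ℝ≥0∞)

/-- The first return time `inf {n ≥ 1 : X_n = x}`. -/
def returnTime (x : M) (ω : ℕ → M) : ℝ≥0∞ :=
  ⨅ (n : ℕ) (_ : 1 ≤ n ∧ ω n = x), (n : ℝ≥0∞)

/-- `T_cov(A)`, the first time at which every point of `A` has been visited. -/
def coverTime (A : Finset M) (ω : ℕ → M) : ℝ≥0∞ :=
  ⨆ x ∈ A, hitTime x ω

/-- `cov₋(A)`, the minimum over `x ∈ A` of `𝔼_x T_cov(A)`. -/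
def covMinus (P : M → PMF M) (A : Finset M) : ℝ≥0∞ :=
  ⨅ x ∈ A, ∫⁻ ω, coverTime A ω ∂(pathLaw P x)

/-- The commute distance `d(x, y) = 𝔼_x T(y) + 𝔼_y T(x)`. -/
def commuteDist (P : M → PMF M) (x y : M) : ℝ≥0∞ :=
  (∫⁻ ω, hitTime y ω ∂(pathLaw P x)) + ∫⁻ ω, hitTime x ω ∂(pathLaw P y)

/-- From every state, every state is reached with positive probability. -/
def IsIrreducible (P : M → PMF M) : Prop :=
  ∀ x y, ∃ n : ℕ, 0 < pathLaw P x {ω | ω n = y}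

/-- The expected return time to every state is finite. -/
def IsPositiveRecurrent (P : M → PMF M) : Prop :=
  ∀ x, ∫⁻ ω, returnTime x ω ∂(pathLaw P x) < ∞

end Chain

/-- Some probability distribution `π` on the states satisfies the detailed balance equations
(it is then an invariant distribution). -/
def IsReversible {M : Type u} (P : M → PMF M) : Prop :=
  ∃ π : PMF M, ∀ x y, π x * P x y = π y * P y x

section Chaining

variable {M : Type u}

/-- The numbers `N_0 = 1` and `N_n = 2 ^ (2 ^ n)` for `n ≥ 1`. -/
def chainingCard (n : ℕ) : ℕ :=
  if n = 0 then 1 else 2 ^ (2 ^ n)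

/-- A sequence of partitions of `A` is admissible if each one is refined by the next one and the
`n`-th one has at most `N_n` elements. In `Finpartition A`, `≤` means `is a refinement of`. -/
structure IsAdmissible [DecidableEq M] {A : Finset M} (𝒜 : ℕ → Finpartition A) : Prop where
  refines : ∀ n, 𝒜 (n + 1) ≤ 𝒜 n
  card_le : ∀ n, (𝒜 n).parts.card ≤ chainingCard n

/-- The diameter `Δ(B, d)` of `B` with respect to `d`. -/
def diam (B : Finset M) (d : M → M → ℝ≥0∞) : ℝ≥0∞ :=
  ⨆ x ∈ B, ⨆ y ∈ B, d x y

open Classical in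
/-- Talagrand's functional `γ₁(A, d)`: the infimum, over the admissible sequences of partitions of
`A`, of the supremum over `x ∈ A` of `∑ₙ 2 ^ n Δ(A_n(x), d)`, where `A_n(x)` is the element of the
`n`-th partition that contains `x`. -/
def gammaOne (A : Finset M) (d : M → M → ℝ≥0∞) : ℝ≥0∞ :=
  ⨅ (𝒜 : ℕ → Finpartition A) (_ : IsAdmissible 𝒜),
    ⨆ x ∈ A, ∑' n : ℕ, (2 : ℝ≥0∞) ^ n * diam ((𝒜 n).part x) d

end Chaining

/-- The chain on `{0, 1}` which from either state moves to `0` with probability `ε` and to `1`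
with probability `1 - ε`. -/
def twoStateChain (ε : ℝ) (hε : ε ∈ Set.Ioo (0 : ℝ) 1) : Fin 2 → PMF (Fin 2) :=
  fun _ => PMF.ofFintype ![ENNReal.ofReal ε, ENNReal.ofReal (1 - ε)] (by
    rw [Fin.sum_univ_two]
    simp only [Matrix.cons_val_zero, Matrix.cons_val_one]
    rw [← ENNReal.ofReal_add hε.1.le (sub_nonneg.2 hε.2.le)]
    simp)

end CoverTime

end

namespace CoverTime

set_option linter.unusedSectionVars false

/-! ### The Markov property at time one. -/

section PathLaw

variable {M : Type u} [MeasurableSpace M] [DiscreteMeasurableSpace M]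

/-- The trajectory `(X_1, X_2, …)`. -/
def shiftPath (ω : ℕ → M) : ℕ → M := fun n => ω (n + 1)

theorem historyKernel_shift (P : M → PMF M) (a : ℕ) (z : ℕ → M) :
    historyKernel P (a + 1) (Preorder.frestrictLe (π := fun _ => M) (a + 1) z) =
      historyKernel P a (Preorder.frestrictLe (π := fun _ => M) a (shiftPath z)) := rfl

/-- The transition rule depends only on the last state and not on the time, so integrating out
coordinates commutes with the shift. The induction is on the number `k` of coordinates to integrate,
peeling off the earliest one. -/
theorem lmarginalPartialTraj_shift (P : M → PMF M) {F Ψ : (ℕ → M) → ℝ≥0∞}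
    (hF : Measurable F) (hΨ : Measurable Ψ) {x : M}
    (h : ∀ ω, ω 0 = x → F ω = Ψ (shiftPath ω)) (b : ℕ) :
    ∀ k a, a + k = b → ∀ z : ℕ → M, z 0 = x →
      Kernel.lmarginalPartialTraj (X := fun _ => M) (historyKernel P) (a + 1) (b + 1) F z =
        Kernel.lmarginalPartialTraj (X := fun _ => M) (historyKernel P) a b Ψ (shiftPath z) := by
  intro k
  induction k with
  | zero =>
    intro a hab z hz
    subst hab
    simp only [add_zero]
    rw [Kernel.lmarginalPartialTraj_le _ le_rfl hF, Kernel.lmarginalPartialTraj_le _ le_rfl hΨ,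
      h z hz]
  | succ k ih =>
    intro a hab z hz
    rw [← Kernel.lmarginalPartialTraj_self (b := a + 2) (by lia) (by lia) hF,
      ← Kernel.lmarginalPartialTraj_self (b := a + 1) (by lia) (by lia) hΨ,
      Kernel.lmarginalPartialTraj_succ _ (Kernel.measurable_lmarginalPartialTraj _ _ hF),
      Kernel.lmarginalPartialTraj_succ _ (Kernel.measurable_lmarginalPartialTraj _ _ hΨ)]
    rw [historyKernel_shift]
    refine lintegral_congr fun y => ?_
    rw [ih (a + 1) (by lia) _ (by simp [Function.update, hz])]
    congr 1
    funext n
    by_cases hn : n = a + 1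
    · subst hn; simp [shiftPath]
    · simp [shiftPath, Function.update, hn]

theorem lintegral_pathLaw_eq_lmarginal (P : M → PMF M) {F : (ℕ → M) → ℝ≥0∞}
    (hF : Measurable F) {b : ℕ} (hd : DependsOn F (Finset.Iic b : Finset ℕ)) (z : ℕ → M) :
    ∫⁻ ω, F ω ∂pathLaw P (z 0) =
      Kernel.lmarginalPartialTraj (X := fun _ => M) (historyKernel P) 0 b F z := by
  have h0 : (fun _ => z 0 : Finset.Iic 0 → M) = Preorder.frestrictLe (π := fun _ => M) 0 z := by
    funext i
    have : i.1 = 0 := Nat.le_zero.1 (Finset.mem_Iic.1 i.2)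
    simp [this]
  rw [Kernel.lmarginalPartialTraj, pathLaw, ← h0, ← Kernel.traj_map_frestrictLe_apply,
    lintegral_map]
  · refine lintegral_congr fun ω => hd fun i hi => ?_
    have hi' : i ∈ Finset.Iic b := hi
    simp only [Function.updateFinset, hi', dif_pos]
    rfl
  · exact hF.comp (measurable_updateFinset (X := fun _ => M))
  · exact Preorder.measurable_frestrictLe b

/-- The Markov property for functionals of finitely many coordinates. Hitting and cover times are
not of this kind, but their truncations at `n` are; monotone convergence then removes the
truncation. -/
theorem lintegral_pathLaw_succ (P : M → PMF M) {F Ψ : (ℕ → M) → ℝ≥0∞}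
    (hF : Measurable F) (hΨ : Measurable Ψ) {x : M}
    (h : ∀ ω, ω 0 = x → F ω = Ψ (shiftPath ω)) {b : ℕ}
    (hdF : DependsOn F (Finset.Iic (b + 1) : Finset ℕ))
    (hdΨ : DependsOn Ψ (Finset.Iic b : Finset ℕ)) :
    ∫⁻ ω, F ω ∂pathLaw P x = ∫⁻ y, ∫⁻ ω, Ψ ω ∂pathLaw P y ∂(P x).toMeasure := by
  have := lintegral_pathLaw_eq_lmarginal P hF hdF (fun _ => x)
  rw [this, ← Kernel.lmarginalPartialTraj_self (b := 1) (by lia) (by lia) hF,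
    Kernel.lmarginalPartialTraj_succ _ (Kernel.measurable_lmarginalPartialTraj _ _ hF)]
  refine lintegral_congr fun y => ?_
  rw [lmarginalPartialTraj_shift P hF hΨ h b b 0 (by simp) _ (by simp),
    ← lintegral_pathLaw_eq_lmarginal P hΨ hdΨ]
  simp [shiftPath]

instance isProbabilityMeasure_pathLaw (P : M → PMF M) (x : M) :
    IsProbabilityMeasure (pathLaw P x) := by
  unfold pathLaw; infer_instance

/-- The expectation of `f(X_1)` for the chain started at `x`. -/
noncomputable def step (P : M → PMF M) (f : M → ℝ≥0∞) (x : M) : ℝ≥0∞ :=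
  ∫⁻ y, f y ∂(P x).toMeasure

theorem step_mono (P : M → PMF M) {f g : M → ℝ≥0∞} (h : ∀ y, f y ≤ g y) (x : M) :
    step P f x ≤ step P g x := lintegral_mono h

theorem step_add (P : M → PMF M) (f g : M → ℝ≥0∞) (x : M) :
    step P (fun y => f y + g y) x = step P f x + step P g x :=
  lintegral_add_left .of_discrete _

theorem step_const (P : M → PMF M) (c : ℝ≥0∞) (x : M) : step P (fun _ => c) x = c := by
  simp [step]

theorem step_const_mul (P : M → PMF M) (c : ℝ≥0∞) (f : M → ℝ≥0∞) (x : M) :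
    step P (fun y => c * f y) x = c * step P f x :=
  lintegral_const_mul _ .of_discrete

theorem step_sum (P : M → PMF M) {ι : Type*} (s : Finset ι) (f : ι → M → ℝ≥0∞) (x : M) :
    step P (fun y => ∑ i ∈ s, f i y) x = ∑ i ∈ s, step P (f i) x :=
  lintegral_finsetSum _ fun _ _ => .of_discrete

theorem step_eq_tsum (P : M → PMF M) (f : M → ℝ≥0∞) (x : M) :
    step P f x = ∑' y, P x y * f y := by
  have h : (P x).toMeasure = Measure.sum fun y => P x y • Measure.dirac y := by
    ext s hs
    rw [Measure.sum_apply _ hs, PMF.toMeasure_apply _ hs]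
    refine tsum_congr fun y => ?_
    by_cases hy : y ∈ s <;> simp [hy]
  rw [step, h, lintegral_sum_measure]
  simp

theorem step_iSup (P : M → PMF M) {f : ℕ → M → ℝ≥0∞} (hf : Monotone f) (x : M) :
    step P (fun y => ⨆ n, f n y) x = ⨆ n, step P (f n) x :=
  lintegral_iSup (fun _ => .of_discrete) hf

theorem mul_le_step (P : M → PMF M) (f : M → ℝ≥0∞) (x y : M) : P x y * f y ≤ step P f x := by
  rw [step_eq_tsum]
  exact ENNReal.le_tsum y

end PathLaw

/-! ### First-step recursions for cover, hitting and return times. -/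

section CoverRecursion

variable {M : Type u} [MeasurableSpace M] [DiscreteMeasurableSpace M]

theorem returnTime_eq (y : M) (ω : ℕ → M) : returnTime y ω = 1 + hitTime y (shiftPath ω) := by
  apply le_antisymm
  · simp only [hitTime, ENNReal.add_iInf]
    refine le_iInf₂ fun n hn => ?_
    have := iInf₂_le (f := fun (n : ℕ) (_ : 1 ≤ n ∧ ω n = y) => (n : ℝ≥0∞)) (n + 1) ⟨by lia, hn⟩
    rw [returnTime]
    calc _ ≤ _ := this
      _ = _ := by push_cast; rw [add_comm]
  · refine le_iInf₂ fun n hn => ?_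
    obtain ⟨n, rfl⟩ : ∃ m, n = m + 1 := ⟨n - 1, by lia⟩
    push_cast
    rw [add_comm]
    gcongr
    exact iInf₂_le n hn.2

theorem hitTime_of_eq {y : M} {ω : ℕ → M} (h : ω 0 = y) : hitTime y ω = 0 := by
  have := iInf₂_le (f := fun (n : ℕ) (_ : ω n = y) => (n : ℝ≥0∞)) 0 h
  simpa [hitTime] using this

theorem hitTime_of_ne {y : M} {ω : ℕ → M} (h : ω 0 ≠ y) :
    hitTime y ω = 1 + hitTime y (shiftPath ω) := by
  rw [← returnTime_eq]
  apply le_antisymm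
  · exact le_iInf₂ fun n hn => iInf₂_le n hn.2
  · refine le_iInf₂ fun n hn => iInf₂_le n ⟨?_, hn⟩
    rcases n with _ | n
    · exact absurd hn h
    · lia

-- The starting point is visited at time 0, so only `A.erase x` remains for the shifted path. The
-- empty case is separate because a supremum over no points is 0, not 1.
open Classical in
theorem coverTime_eq {A : Finset M} {x : M} {ω : ℕ → M} (hx : ω 0 = x) :
    coverTime A ω =
      if A.erase x = ∅ then 0 else 1 + coverTime (A.erase x) (shiftPath ω) := by
  have h1 : coverTime A ω = ⨆ y ∈ A.erase x, (1 + hitTime y (shiftPath ω)) := by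
    apply le_antisymm
    · refine iSup₂_le fun y hy => ?_
      by_cases hxy : ω 0 = y
      · simp [hitTime_of_eq hxy]
      · rw [hitTime_of_ne hxy]
        exact le_iSup₂ (f := fun y (_ : y ∈ A.erase x) => 1 + hitTime y (shiftPath ω)) y
          (Finset.mem_erase.2 ⟨fun h => hxy (hx.trans h.symm), hy⟩)
    · refine iSup₂_le fun y hy => ?_
      rw [← hitTime_of_ne (fun h => (Finset.mem_erase.1 hy).1 (h.symm.trans hx))]
      exact le_iSup₂ (f := fun y (_ : y ∈ A) => hitTime y ω) y (Finset.mem_of_mem_erase hy)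
  split_ifs with h
  · rw [h1, h]; simp
  · have hne : (A.erase x).Nonempty := Finset.nonempty_iff_ne_empty.2 h
    rw [h1, coverTime]
    exact (ENNReal.add_biSup (s := (A.erase x : Set M)) hne _).symm

theorem measurable_hitTime (y : M) : Measurable (hitTime y) := by
  unfold hitTime
  refine .iInf fun n => ?_
  have : (fun ω : ℕ → M => ⨅ (_ : ω n = y), (n : ℝ≥0∞)) =
      fun ω => ({y} : Set M).indicator (fun _ => (n : ℝ≥0∞)) (ω n) +
        ({y}ᶜ : Set M).indicator (fun _ => ⊤) (ω n) := by
    funext ω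
    by_cases h : ω n = y <;> simp [h]
  rw [this]
  have hn : Measurable fun ω : ℕ → M => ω n := measurable_pi_apply n
  exact ((measurable_const.indicator (.of_discrete (s := {y}))).comp hn).add
    ((measurable_const.indicator (.of_discrete (s := {y}ᶜ))).comp hn)

theorem measurable_coverTime (A : Finset M) : Measurable (coverTime A) :=
  .biSup _ A.countable_toSet fun y _ => measurable_hitTime y

theorem dependsOn_min_hitTime (y : M) (n : ℕ) :
    DependsOn (fun ω => min (hitTime y ω) n) (Finset.Iic n : Finset ℕ) := by
  have key : ∀ ω ω' : ℕ → M, (∀ i ∈ (Finset.Iic n : Finset ℕ), ω i = ω' i) →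
      min (hitTime y ω) n ≤ min (hitTime y ω') n := by
    refine fun ω ω' h => le_min (le_iInf₂ fun k hk => ?_) (min_le_right _ _)
    rcases le_total k n with hkn | hkn
    · exact (min_le_left _ _).trans (iInf₂_le k ((h k (Finset.mem_Iic.2 hkn)).trans hk))
    · exact (min_le_right _ _).trans (by exact_mod_cast hkn)
  exact fun ω ω' h => le_antisymm (key _ _ h) (key _ _ fun i hi => (h i hi).symm)

theorem dependsOn_min_coverTime (A : Finset M) (n : ℕ) :
    DependsOn (fun ω => min (coverTime A ω) n) (Finset.Iic n : Finset ℕ) := by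
  intro ω ω' h
  have := fun y => dependsOn_min_hitTime y n h
  simp only [coverTime, iSup_inf_eq] at this ⊢
  simp only [this]

/-- `𝔼_x min(T_cov(A), n)`. -/
noncomputable def covTrunc (P : M → PMF M) (n : ℕ) (A : Finset M) (x : M) : ℝ≥0∞ :=
  ∫⁻ ω, min (coverTime A ω) n ∂pathLaw P x

/-- `𝔼_x T_cov(A)`. -/
noncomputable def expCov (P : M → PMF M) (A : Finset M) (x : M) : ℝ≥0∞ :=
  ∫⁻ ω, coverTime A ω ∂pathLaw P x

theorem covTrunc_zero (P : M → PMF M) (A : Finset M) (x : M) : covTrunc P 0 A x = 0 := by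
  simp [covTrunc]

theorem covTrunc_mono_nat (P : M → PMF M) (A : Finset M) (x : M) :
    Monotone fun n => covTrunc P n A x := by
  intro m n h
  refine lintegral_mono fun ω => ?_
  dsimp only
  gcongr

theorem expCov_eq_iSup (P : M → PMF M) (A : Finset M) (x : M) :
    expCov P A x = ⨆ n, covTrunc P n A x := by
  unfold covTrunc
  rw [← lintegral_iSup (fun n => (measurable_coverTime A).min measurable_const)
    (fun m n h ω => by dsimp only; gcongr)]
  refine lintegral_congr fun ω => ?_
  simp only [← inf_iSup_eq, ENNReal.iSup_natCast, inf_top_eq]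

theorem covTrunc_le (P : M → PMF M) (n : ℕ) (A : Finset M) (x : M) :
    covTrunc P n A x ≤ expCov P A x :=
  lintegral_mono fun _ => min_le_left _ _

theorem expCov_mono (P : M → PMF M) {A B : Finset M} (h : A ⊆ B) (x : M) :
    expCov P A x ≤ expCov P B x :=
  lintegral_mono fun _ => biSup_mono fun _ hy => h hy

open Classical in
theorem covTrunc_succ (P : M → PMF M) (n : ℕ) (A : Finset M) (x : M) :
    covTrunc P (n + 1) A x =
      if A.erase x = ∅ then 0 else 1 + step P (covTrunc P n (A.erase x)) x := by
  have hm : ∀ B : Finset M, ∀ k : ℕ, Measurable fun ω : ℕ → M => min (coverTime B ω) k :=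
    fun B k => (measurable_coverTime B).min measurable_const
  split_ifs with h
  · have h0 : ∀ ω : ℕ → M, ω 0 = x → min (coverTime A ω) ((n + 1 : ℕ) : ℝ≥0∞) = 0 := by
      intro ω hω
      rw [coverTime_eq hω, if_pos h]; simp
    rw [covTrunc, lintegral_pathLaw_succ P (hm A (n + 1)) (Ψ := fun _ => 0) measurable_const
      h0 (dependsOn_min_coverTime A (n + 1)) (fun _ _ _ => rfl)]
    simp
  · have h0 : ∀ ω : ℕ → M, ω 0 = x → min (coverTime A ω) ((n + 1 : ℕ) : ℝ≥0∞) =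
        1 + min (coverTime (A.erase x) (shiftPath ω)) n := by
      intro ω hω
      rw [coverTime_eq hω, if_neg h, Nat.cast_add, Nat.cast_one, add_comm (n : ℝ≥0∞),
        min_add_add_left]
    rw [covTrunc, lintegral_pathLaw_succ P (hm A (n + 1))
      (Ψ := fun ω => 1 + min (coverTime (A.erase x) ω) n) (measurable_const.add (hm _ n))
      h0 (dependsOn_min_coverTime A (n + 1))
      (fun ω ω' h => congrArg (1 + ·) (dependsOn_min_coverTime (A.erase x) n h))]
    have : ∀ y, ∫⁻ ω, 1 + min (coverTime (A.erase x) ω) n ∂pathLaw P y =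
        1 + covTrunc P n (A.erase x) y := by
      intro y
      rw [lintegral_add_left measurable_const]; simp [covTrunc]
    simp only [this]
    change step P (fun y => 1 + covTrunc P n (A.erase x) y) x = _
    rw [step_add, step_const]

open Classical in
theorem expCov_eq (P : M → PMF M) (A : Finset M) (x : M) :
    expCov P A x = if A.erase x = ∅ then 0 else 1 + step P (expCov P (A.erase x)) x := by
  have h1 : expCov P A x = ⨆ n, covTrunc P (n + 1) A x := by
    rw [expCov_eq_iSup]
    exact ((covTrunc_mono_nat P A x).iSup_nat_add 1).symm
  simp only [h1, covTrunc_succ]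
  split_ifs with h
  · simp
  · have : expCov P (A.erase x) = fun y => ⨆ n, covTrunc P n (A.erase x) y :=
      funext fun y => expCov_eq_iSup P _ y
    rw [this, step_iSup P (fun m n h y => covTrunc_mono_nat P _ y h), ENNReal.add_iSup]

/-- `𝔼_x T(y)`. -/
noncomputable def expHit (P : M → PMF M) (x y : M) : ℝ≥0∞ :=
  ∫⁻ ω, hitTime y ω ∂pathLaw P x

theorem expHit_eq_expCov (P : M → PMF M) (x y : M) : expHit P x y = expCov P {y} x := by
  simp [expHit, expCov, coverTime]

theorem expHit_self (P : M → PMF M) (x : M) : expHit P x x = 0 := by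
  classical
  rw [expHit_eq_expCov, expCov_eq]
  simp

theorem expHit_of_ne (P : M → PMF M) {x y : M} (h : x ≠ y) :
    expHit P x y = 1 + step P (fun w => expHit P w y) x := by
  classical
  simp only [expHit_eq_expCov]
  rw [expCov_eq, Finset.erase_eq_of_notMem (by simpa using h)]
  simp

/-- `𝔼_x min(T(y), n)`. -/
noncomputable def hitTrunc (P : M → PMF M) (n : ℕ) (x y : M) : ℝ≥0∞ := covTrunc P n {y} x

theorem hitTrunc_zero (P : M → PMF M) (x y : M) : hitTrunc P 0 x y = 0 := covTrunc_zero ..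

theorem hitTrunc_le (P : M → PMF M) (n : ℕ) (x y : M) : hitTrunc P n x y ≤ expHit P x y := by
  rw [expHit_eq_expCov]; exact covTrunc_le ..

theorem expHit_eq_iSup (P : M → PMF M) (x y : M) : expHit P x y = ⨆ n, hitTrunc P n x y := by
  rw [expHit_eq_expCov]; exact expCov_eq_iSup ..

theorem hitTrunc_succ_self (P : M → PMF M) (n : ℕ) (x : M) : hitTrunc P (n + 1) x x = 0 := by
  classical
  rw [hitTrunc, covTrunc_succ]; simp

theorem hitTrunc_succ_of_ne (P : M → PMF M) (n : ℕ) {x y : M} (h : x ≠ y) :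
    hitTrunc P (n + 1) x y = 1 + step P (fun w => hitTrunc P n w y) x := by
  classical
  rw [hitTrunc, covTrunc_succ, Finset.erase_eq_of_notMem (by simpa using h)]
  simp [hitTrunc]

theorem hitTrunc_succ_le (P : M → PMF M) (n : ℕ) (x y : M) :
    hitTrunc P (n + 1) x y ≤ 1 + step P (fun w => hitTrunc P n w y) x := by
  by_cases h : x = y
  · subst h; rw [hitTrunc_succ_self]; exact zero_le
  · exact (hitTrunc_succ_of_ne P n h).le

theorem lintegral_returnTime (P : M → PMF M) (x : M) :
    ∫⁻ ω, returnTime x ω ∂pathLaw P x = 1 + step P (fun w => expHit P w x) x := by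
  have hm : ∀ k : ℕ, Measurable fun ω : ℕ → M => min (hitTime x ω) k :=
    fun k => (measurable_hitTime x).min measurable_const
  have hms : ∀ k : ℕ, Measurable fun ω : ℕ → M => min (hitTime x (shiftPath ω)) k :=
    fun k => (hm k).comp (measurable_pi_lambda _ fun n => measurable_pi_apply (n + 1))
  have h1 : ∀ n : ℕ, ∫⁻ ω, min (hitTime x (shiftPath ω)) n ∂pathLaw P x =
      step P (fun w => hitTrunc P n w x) x := by
    intro n
    rw [lintegral_pathLaw_succ P (hms n) (hm n) (fun ω _ => rfl) (b := n)
      (fun ω ω' h => dependsOn_min_hitTime x n fun i hi => h (i + 1) ?_)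
      (dependsOn_min_hitTime x n)]
    · simp [step, hitTrunc, covTrunc, coverTime]
    · simp only [Finset.coe_Iic, Set.mem_Iic] at hi ⊢
      lia
  have h2 : ∀ ω : ℕ → M, hitTime x (shiftPath ω) = ⨆ n : ℕ, min (hitTime x (shiftPath ω)) n := by
    intro ω
    simp only [← inf_iSup_eq, ENNReal.iSup_natCast, inf_top_eq]
  simp only [returnTime_eq]
  rw [lintegral_add_left measurable_const]
  simp only [lintegral_const, measure_univ, mul_one]
  congr 1
  rw [lintegral_congr h2, lintegral_iSup hms
    (fun m n h ω => by dsimp only; gcongr)]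
  simp only [h1, expHit_eq_iSup]
  exact (step_iSup P (fun m n h y => covTrunc_mono_nat P _ y h) x).symm

open Classical in
theorem pathLaw_succ_eq (P : M → PMF M) (n : ℕ) (x y : M) :
    pathLaw P x {ω | ω (n + 1) = y} = step P (fun w => pathLaw P w {ω | ω n = y}) x := by
  have hm : ∀ k : ℕ, MeasurableSet {ω : ℕ → M | ω k = y} := fun k =>
    (measurable_pi_apply k : Measurable fun ω : ℕ → M => ω k) (.of_discrete (s := {y}))
  have hd : ∀ k : ℕ, DependsOn ({ω : ℕ → M | ω k = y}.indicator (1 : (ℕ → M) → ℝ≥0∞))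
      (Finset.Iic k : Finset ℕ) := by
    intro k ω ω' h
    have := h k (by simp)
    simp only [Set.indicator, Set.mem_ofPred_eq, this]; rfl
  simp only [← lintegral_indicator_one (hm _)]
  exact lintegral_pathLaw_succ P (measurable_one.indicator (hm _))
    (measurable_one.indicator (hm n)) (fun ω _ => by simp only [Set.indicator]; rfl)
    (hd (n + 1)) (hd n)

open Classical in
theorem pathLaw_zero_eq (P : M → PMF M) (x y : M) :
    pathLaw P x {ω | ω 0 = y} = if x = y then 1 else 0 := by
  have hm : MeasurableSet {ω : ℕ → M | ω 0 = y} :=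
    (measurable_pi_apply 0 : Measurable fun ω : ℕ → M => ω 0) (.of_discrete (s := {y}))
  have := lintegral_pathLaw_eq_lmarginal P (b := 0)
    (measurable_one.indicator hm : Measurable (_ : (ℕ → M) → ℝ≥0∞))
    (fun ω ω' h => by simp [Set.indicator, h 0 (by simp)]) (fun _ => x)
  rw [lintegral_indicator_one hm,
    Kernel.lmarginalPartialTraj_le _ le_rfl (measurable_one.indicator hm)] at this
  rw [this]
  simp [Set.indicator]

theorem eq_of_pathLaw_zero_pos {P : M → PMF M} {x y : M}
    (h : 0 < pathLaw P x {ω | ω 0 = y}) : x = y := by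
  by_contra hxy
  simp [pathLaw_zero_eq, hxy] at h

end CoverRecursion

/-! ### Comparison principle, triangle inequality and finiteness of hitting times. -/

section HittingTimes

variable {M : Type u} [MeasurableSpace M] [DiscreteMeasurableSpace M]

open Classical in
/-- The probability that the chain started at `x` avoids `A` at the times `0, …, n - 1`. -/
noncomputable def avoidProb (P : M → PMF M) (A : Finset M) : ℕ → M → ℝ≥0∞
  | 0, _ => 1
  | n + 1, x => if x ∈ A then 0 else step P (avoidProb P A n) x

theorem avoidProb_of_mem (P : M → PMF M) {A : Finset M} (n : ℕ) {x : M} (hx : x ∈ A) :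
    avoidProb P A (n + 1) x = 0 := by simp [avoidProb, hx]

theorem avoidProb_of_notMem (P : M → PMF M) {A : Finset M} (n : ℕ) {x : M} (hx : x ∉ A) :
    avoidProb P A (n + 1) x = step P (avoidProb P A n) x := by simp [avoidProb, hx]

/-- The left side is the tail sum for the expectation of the hitting time of `A` truncated at `n`,
and `A` is hit no later than `u`. -/
theorem sum_avoidProb_le (P : M → PMF M) {A : Finset M} {u : M} (hu : u ∈ A) (n : ℕ) (x : M) :
    ∑ k ∈ Finset.range n, avoidProb P A (k + 1) x ≤ hitTrunc P n x u := by
  induction n generalizing x with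
  | zero => simp
  | succ n ih =>
    by_cases hx : x ∈ A
    · simp [avoidProb_of_mem P _ hx]
    · rw [hitTrunc_succ_of_ne P n (ne_of_mem_of_not_mem hu hx).symm, Finset.sum_range_succ', add_comm]
      simp only [avoidProb_of_notMem P _ hx, ← step_sum]
      gcongr
      · simp [avoidProb, step_const]
      · exact step_mono P (fun y => ih y) x

theorem tendsto_avoidProb (P : M → PMF M) {A : Finset M} {u : M} (hu : u ∈ A) {x : M}
    (hx : expHit P x u ≠ ∞) :
    Filter.Tendsto (fun n => avoidProb P A n x) Filter.atTop (nhds 0) := by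
  rw [← Filter.tendsto_add_atTop_iff_nat 1]
  apply ENNReal.tendsto_atTop_zero_of_tsum_ne_top
  refine ne_top_of_le_ne_top hx ?_
  rw [ENNReal.tsum_eq_iSup_nat]
  exact iSup_le fun n => (sum_avoidProb_le P hu n x).trans (hitTrunc_le P n x u)

theorem expCov_of_notMem (P : M → PMF M) {A : Finset M} (hA : A.Nonempty) {x : M} (hx : x ∉ A) :
    expCov P A x = 1 + step P (expCov P A) x := by
  classical
  rw [expCov_eq, Finset.erase_eq_of_notMem hx, if_neg hA.ne_empty]

/-- A maximum principle: the inequality need only be checked on `A`. Off `A`, one step adds exactly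
1 to the cover time and at most `∑ w i ≤ 1` to the weighted hitting times. Truncating the latter
lets the induction start with error `E`, carried by the probability of not yet having met `A`; this
probability tends to 0, and `E` is finite. -/
theorem sum_mul_expHit_add_le_expCov (P : M → PMF M) {A : Finset M} (hA : A.Nonempty)
    (hfin : ∀ x y, expHit P x y ≠ ∞) {ι : Type*} (s : Finset ι) (w : ι → ℝ≥0∞)
    (hw : ∑ i ∈ s, w i ≤ 1) (t : ι → M) {δ E : ℝ≥0∞} (hE : E ≠ ∞)
    (hb : ∀ x ∈ A, ∑ i ∈ s, w i * expHit P x (t i) + E ≤ expCov P A x + δ) (x : M) :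
    ∑ i ∈ s, w i * expHit P x (t i) + E ≤ expCov P A x + δ := by
  have key : ∀ n x, ∑ i ∈ s, w i * hitTrunc P n x (t i) + E ≤
      expCov P A x + δ + avoidProb P A n x * E := by
    intro n
    induction n with
    | zero => intro x; simp [hitTrunc_zero, avoidProb]
    | succ n ih =>
      intro x
      by_cases hx : x ∈ A
      · refine le_trans ?_ ((hb x hx).trans le_self_add)
        gcongr
        exact hitTrunc_le ..
      · rw [expCov_of_notMem P hA hx, avoidProb_of_notMem P n hx]
        calc ∑ i ∈ s, w i * hitTrunc P (n + 1) x (t i) + E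
            ≤ ∑ i ∈ s, w i * (1 + step P (fun y => hitTrunc P n y (t i)) x) + E := by
              gcongr; exact hitTrunc_succ_le ..
          _ = ∑ i ∈ s, w i + step P (fun y => ∑ i ∈ s, w i * hitTrunc P n y (t i) + E) x := by
              rw [step_add, step_sum, step_const]
              simp only [step_const_mul, mul_add, mul_one, Finset.sum_add_distrib, add_assoc]
          _ ≤ 1 + step P (fun y => expCov P A y + δ + avoidProb P A n y * E) x := by
              gcongr; exact step_mono P ih x
          _ = _ := by
              simp only [mul_comm _ E]
              rw [step_add, step_add, step_const, step_const_mul]; ring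
  obtain ⟨u, hu⟩ := hA
  have hw' : ∀ i ∈ s, w i ≠ ∞ := fun i hi =>
    ne_top_of_le_ne_top ENNReal.one_ne_top ((Finset.single_le_sum (fun _ _ => zero_le) hi).trans hw)
  refine le_of_tendsto_of_tendsto' (b := Filter.atTop)
    (f := fun n => ∑ i ∈ s, w i * hitTrunc P n x (t i) + E)
    (g := fun n => expCov P A x + δ + avoidProb P A n x * E) ?_ ?_ (fun n => key n x)
  · refine Filter.Tendsto.add (tendsto_finsetSum _ fun i hi => ?_) tendsto_const_nhds
    refine ENNReal.Tendsto.const_mul ?_ (Or.inr (hw' i hi))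
    rw [expHit_eq_iSup]
    exact tendsto_atTop_iSup (covTrunc_mono_nat P _ x)
  · have := ENNReal.Tendsto.mul_const (b := E) (tendsto_avoidProb P hu (hfin x u)) (Or.inr hE)
    simpa using this.const_add (expCov P A x + δ)

theorem le_expCov_of_le (P : M → PMF M) {A : Finset M} (hA : A.Nonempty)
    (hfin : ∀ x y, expHit P x y ≠ ∞) {E : ℝ≥0∞} (hb : ∀ x ∈ A, E ≤ expCov P A x) (x : M) :
    E ≤ expCov P A x := by
  -- `E` may be infinite, whereas the comparison principle needs a finite constant.
  refine ENNReal.le_of_forall_nnreal_lt fun r hr => ?_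
  have := sum_mul_expHit_add_le_expCov P hA hfin (∅ : Finset ℕ) 0 (by simp) (fun _ => x)
    (δ := 0) (E := r) (by simp) (fun y hy => by simpa using hr.le.trans (hb y hy)) x
  simpa using this

theorem covMinus_eq (P : M → PMF M) (A : Finset M) : covMinus P A = ⨅ x ∈ A, expCov P A x := rfl

theorem covMinus_le_expCov (P : M → PMF M) {A : Finset M} (hA : A.Nonempty)
    (hfin : ∀ x y, expHit P x y ≠ ∞) (x : M) : covMinus P A ≤ expCov P A x :=
  le_expCov_of_le P hA hfin (fun _ hy => iInf₂_le _ hy) x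

/-- The minimum over the larger set may be attained outside `A`; this is harmless because starting
outside `A` never beats `covMinus P A`. -/
theorem covMinus_mono (P : M → PMF M) (hfin : ∀ x y, expHit P x y ≠ ∞) {A B : Finset M}
    (hA : A.Nonempty) (h : A ⊆ B) : covMinus P A ≤ covMinus P B :=
  le_iInf₂ fun x _ => (covMinus_le_expCov P hA hfin x).trans (expCov_mono P h x)

theorem expHit_triangle (P : M → PMF M) (x y z : M) :
    expHit P x z ≤ expHit P x y + expHit P y z := by
  rw [expHit_eq_iSup P x z]
  refine iSup_le fun n => ?_
  induction n generalizing x with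
  | zero => simp [hitTrunc_zero]
  | succ n ih =>
    by_cases hxy : x = y
    · subst hxy
      rw [expHit_self, zero_add]
      exact hitTrunc_le ..
    · calc hitTrunc P (n + 1) x z ≤ 1 + step P (fun w => hitTrunc P n w z) x :=
            hitTrunc_succ_le ..
        _ ≤ 1 + step P (fun w => expHit P w y + expHit P y z) x := by
            gcongr; exact step_mono P ih x
        _ = _ := by rw [step_add, step_const, ← add_assoc, ← expHit_of_ne P hxy]

theorem step_expHit_ne_top {P : M → PMF M} (hpos : IsPositiveRecurrent P) {x z : M}
    (h : expHit P x z ≠ ∞) : step P (fun w => expHit P w z) x ≠ ∞ := by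
  by_cases hxz : x = z
  · subst hxz
    have := hpos x
    rw [lintegral_returnTime] at this
    exact ne_top_of_le_ne_top this.ne le_add_self
  · rw [expHit_of_ne P hxz] at h
    exact ne_top_of_le_ne_top h le_add_self

/-- A finite mean return time to `z` forces a finite hitting time of `z` from each possible
successor of `z`; this propagates along a path from `z` to `x`. -/
theorem expHit_ne_top {P : M → PMF M} (hirr : IsIrreducible P) (hpos : IsPositiveRecurrent P)
    (x z : M) : expHit P x z ≠ ∞ := by
  have key : ∀ n y, expHit P y z ≠ ∞ → 0 < pathLaw P y {ω | ω n = x} → expHit P x z ≠ ∞ := by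
    intro n
    induction n with
    | zero => intro y hy h; rwa [← eq_of_pathLaw_zero_pos h]
    | succ n ih =>
      intro y hy h
      rw [pathLaw_succ_eq, step_eq_tsum] at h
      obtain ⟨w, hw⟩ := not_forall.1 (mt ENNReal.tsum_eq_zero.2 h.ne')
      refine ih w (fun hw' => step_expHit_ne_top hpos hy ?_)
        (pos_iff_ne_zero.2 (right_ne_zero_of_mul hw))
      have := mul_le_step P (fun w => expHit P w z) y w
      rw [hw', ENNReal.mul_top (left_ne_zero_of_mul hw)] at this
      exact top_le_iff.1 this
  obtain ⟨n, hn⟩ := hirr z x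
  exact key n z (by simp [expHit_self]) hn

end HittingTimes

/-! ### Symmetry of the Dirichlet form under detailed balance. -/

section Reversible

/-- A bounded function is summable against a nonnegative summable weight. -/
theorem summable_mul_of_bounded {ι : Type*} {J : ι → ℝ} (hJ : Summable J) (h0 : ∀ i, 0 ≤ J i)
    {φ : ι → ℝ} {C : ℝ} (hφ : ∀ i, |φ i| ≤ C) : Summable fun i => J i * φ i := by
  refine Summable.of_norm_bounded (hJ.mul_right C) fun i => ?_
  rw [Real.norm_eq_abs, abs_mul, abs_of_nonneg (h0 i)]
  exact mul_le_mul_of_nonneg_left (hφ i) (h0 i)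

theorem summable_toReal_pmf {α : Type*} (p : PMF α) : Summable fun a => (p a).toReal :=
  ENNReal.summable_toReal p.tsum_coe_ne_top

theorem tsum_toReal_pmf {α : Type*} (p : PMF α) : ∑' a, (p a).toReal = 1 := by
  rw [← ENNReal.tsum_toReal_eq (fun a => p.apply_ne_top a), p.tsum_coe, ENNReal.toReal_one]

variable {M : Type u} {P : M → PMF M} {π : PMF M}

theorem summable_joint (P : M → PMF M) (π : PMF M) :
    Summable fun q : M × M => (π q.1).toReal * (P q.1 q.2).toReal := by
  have : ∑' q : M × M, π q.1 * P q.1 q.2 ≠ ∞ := by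
    rw [ENNReal.tsum_prod (f := fun x y => π x * P x y)]
    simp [ENNReal.tsum_mul_left, PMF.tsum_coe]
  simpa using ENNReal.summable_toReal this

theorem tsum_form_symm (hrev : ∀ x y, π x * P x y = π y * P y x) {f g : M → ℝ} {C : ℝ}
    (hf : ∀ x, |f x| ≤ C) (hg : ∀ x, |g x| ≤ C) :
    ∑' x, (π x).toReal * (g x * ∑' y, (P x y).toReal * f y) =
      ∑' x, (π x).toReal * (f x * ∑' y, (P x y).toReal * g y) := by
  have hs : ∀ {a b : M → ℝ}, (∀ x, |a x| ≤ C) → (∀ x, |b x| ≤ C) →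
      Summable (Function.uncurry fun x y => (π x).toReal * (P x y).toReal * (a x * b y)) :=
    fun ha hb => summable_mul_of_bounded (φ := fun q : M × M => _) (summable_joint P π)
      (fun _ => by positivity) (C := C * C) fun q => by
        rw [abs_mul]
        exact mul_le_mul (ha _) (hb _) (abs_nonneg _) ((abs_nonneg _).trans (ha q.1))
  have h1 : ∀ a b : M → ℝ, ∑' x, (π x).toReal * (a x * ∑' y, (P x y).toReal * b y) =
      ∑' x, ∑' y, (π x).toReal * (P x y).toReal * (a x * b y) := by
    intro a b
    refine tsum_congr fun x => ?_
    rw [← tsum_mul_left, ← tsum_mul_left]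
    exact tsum_congr fun y => by ring
  rw [h1, h1, ← (hs hf hg).tsum_comm]
  refine tsum_congr fun x => tsum_congr fun y => ?_
  have := congrArg ENNReal.toReal (hrev x y)
  simp only [ENNReal.toReal_mul] at this
  rw [← this]
  ring

theorem tsum_dirichlet_symm (hrev : ∀ x y, π x * P x y = π y * P y x) {f g : M → ℝ} {C : ℝ}
    (hf : ∀ x, |f x| ≤ C) (hg : ∀ x, |g x| ≤ C) :
    ∑' x, (π x).toReal * (g x * (f x - ∑' y, (P x y).toReal * f y)) =
      ∑' x, (π x).toReal * (f x * (g x - ∑' y, (P x y).toReal * g y)) := by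
  have hP : ∀ {b : M → ℝ}, (∀ x, |b x| ≤ C) → ∀ x, |∑' y, (P x y).toReal * b y| ≤ C := by
    intro b hb x
    have hsum := (summable_toReal_pmf (P x)).mul_right C
    have hle : ∀ y, ‖(P x y).toReal * b y‖ ≤ (P x y).toReal * C := fun y => by
      rw [Real.norm_eq_abs, abs_mul, abs_of_nonneg ENNReal.toReal_nonneg]
      exact mul_le_mul_of_nonneg_left (hb y) ENNReal.toReal_nonneg
    have := tsum_of_norm_bounded hsum.hasSum hle
    rwa [tsum_mul_right, tsum_toReal_pmf, one_mul] at this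
  have hs : ∀ {a b : M → ℝ}, (∀ x, |a x| ≤ C) → (∀ x, |b x| ≤ C) →
      Summable fun x => (π x).toReal * (a x * b x) := fun ha hb =>
    summable_mul_of_bounded (summable_toReal_pmf π) (fun _ => by positivity) (C := C * C)
      fun q => by
        rw [abs_mul]
        exact mul_le_mul (ha _) (hb _) (abs_nonneg _) ((abs_nonneg _).trans (ha q))
  have h1 : ∀ {a b : M → ℝ}, (∀ x, |a x| ≤ C) → (∀ x, |b x| ≤ C) →
      ∑' x, (π x).toReal * (a x * (b x - ∑' y, (P x y).toReal * b y)) =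
        ∑' x, (π x).toReal * (a x * b x) -
          ∑' x, (π x).toReal * (a x * ∑' y, (P x y).toReal * b y) := by
    intro a b ha hb
    rw [← (hs ha hb).tsum_sub (hs ha (hP hb))]
    exact tsum_congr fun x => by ring
  rw [h1 hg hf, h1 hf hg, tsum_form_symm hrev hf hg]
  congr 1
  exact tsum_congr fun x => by ring

end Reversible

/-! ### The cyclic identity for hitting times. -/

section Cyclic

variable {M : Type u} [MeasurableSpace M] [DiscreteMeasurableSpace M]

/-- Poisson equation for the hitting time of `z`; the constant `c` is the mean return time to `z`.
-/
theorem expHit_sub_step {P : M → PMF M} (hirr : IsIrreducible P) (hpos : IsPositiveRecurrent P)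
    (z : M) : ∃ c : ℝ, 1 ≤ c ∧ ∀ x, Summable (fun w => (P x w).toReal * (expHit P w z).toReal) ∧
      (expHit P x z).toReal - ∑' w, (P x w).toReal * (expHit P w z).toReal =
        1 - Set.indicator {z} (fun _ => c) x := by
  have hst : ∀ x, step P (fun w => expHit P w z) x ≠ ∞ := fun x =>
    step_expHit_ne_top hpos (expHit_ne_top hirr hpos x z)
  have hne : ∀ x w, P x w * expHit P w z ≠ ∞ := fun x w =>
    ENNReal.mul_ne_top ((P x).apply_ne_top w) (expHit_ne_top hirr hpos w z)
  have hts : ∀ x, ∑' w, (P x w).toReal * (expHit P w z).toReal =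
      (step P (fun w => expHit P w z) x).toReal := by
    intro x
    rw [step_eq_tsum, ENNReal.tsum_toReal_eq (hne x)]
    simp only [ENNReal.toReal_mul]
  refine ⟨1 + (step P (fun w => expHit P w z) z).toReal, by simp, fun x => ⟨?_, ?_⟩⟩
  · have := hst x
    rw [step_eq_tsum] at this
    simpa only [ENNReal.toReal_mul] using ENNReal.summable_toReal this
  · rw [hts]
    by_cases hxz : x = z
    · subst hxz; simp [expHit_self]
    · rw [expHit_of_ne P hxz, ENNReal.toReal_add ENNReal.one_ne_top (hst x)]
      simp [hxz]

theorem abs_expHit_sub_le {P : M → PMF M} (hfin : ∀ x y, expHit P x y ≠ ∞) (x y z : M) :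
    |(expHit P x z).toReal - (expHit P x y).toReal| ≤
      (expHit P y z).toReal + (expHit P z y).toReal := by
  have h : ∀ y z, (expHit P x z).toReal ≤ (expHit P x y).toReal + (expHit P y z).toReal := by
    intro y z
    rw [← ENNReal.toReal_add (hfin _ _) (hfin _ _)]
    exact ENNReal.toReal_mono (ENNReal.add_ne_top.2 ⟨hfin _ _, hfin _ _⟩)
      (expHit_triangle P x y z)
  have h1 := h y z
  have h2 := h z y
  have h3 : 0 ≤ (expHit P y z).toReal := ENNReal.toReal_nonneg
  have h4 : 0 ≤ (expHit P z y).toReal := ENNReal.toReal_nonneg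
  rw [abs_le]
  constructor <;> linarith

/-- Hitting times may be unbounded in the starting point, but by the triangle inequality the
difference of those of two targets is bounded, so the Dirichlet form applies to it. Its image under
the generator is supported on the two targets, so symmetry of the form compares finitely many
hitting times. -/
theorem expHit_cyclic {P : M → PMF M} (hirr : IsIrreducible P) (hpos : IsPositiveRecurrent P)
    (hrev : IsReversible P) (x y z : M) :
    (expHit P x y).toReal + (expHit P y z).toReal + (expHit P z x).toReal =
      (expHit P y x).toReal + (expHit P z y).toReal + (expHit P x z).toReal := by
  obtain ⟨π, hπ⟩ := hrev
  have hfin := expHit_ne_top hirr hpos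
  choose c hc1 hsum heq using fun z => expHit_sub_step hirr hpos z
  set f : M → M → M → ℝ := fun y z w => (expHit P w z).toReal - (expHit P w y).toReal with hf
  have hfb : ∀ y z w, |f y z w| ≤ (expHit P y z).toReal + (expHit P z y).toReal := fun y z w =>
    abs_expHit_sub_le hfin w y z
  have hfe : ∀ y z w, f y z w - ∑' v, (P w v).toReal * f y z v =
      Set.indicator {y} (fun _ => c y) w - Set.indicator {z} (fun _ => c z) w := by
    intro y z w
    have h1 := heq z w
    have h2 := heq y w
    have : ∑' v, (P w v).toReal * f y z v =
        ∑' v, (P w v).toReal * (expHit P v z).toReal -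
          ∑' v, (P w v).toReal * (expHit P v y).toReal := by
      rw [← (hsum z w).tsum_sub (hsum y w)]
      exact tsum_congr fun v => by simp only [hf]; ring
    rw [this]
    simp only [hf]
    linarith
  have hpair : ∀ (g : M → ℝ) (y z : M), ∑' w, (π w).toReal * (g w *
      (f y z w - ∑' v, (P w v).toReal * f y z v)) =
        (π y).toReal * c y * g y - (π z).toReal * c z * g z := by
    intro g y z
    have hone : ∀ y, HasSum (fun w => (π w).toReal * (g w * Set.indicator {y} (fun _ => c y) w))
        ((π y).toReal * c y * g y) := by
      intro y
      convert hasSum_single (f := fun w => (π w).toReal *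
        (g w * Set.indicator {y} (fun _ => c y) w)) y ?_ using 1
      · simp; ring
      · intro w hw; simp [hw]
    rw [← ((hone y).sub (hone z)).tsum_eq]
    exact tsum_congr fun w => by rw [hfe]; ring
  -- Pairing with the constant function 1, whose image is 0: stationary mass times mean return time
  -- is the same at all states.
  have hconst : ∀ y z, (π y).toReal * c y = (π z).toReal * c z := by
    intro y z
    have h1 := hpair (fun _ => 1) y z
    have h2 := tsum_dirichlet_symm hπ (f := f y z) (g := fun _ => (1 : ℝ))
      (C := max 1 ((expHit P y z).toReal + (expHit P z y).toReal))
      (fun w => (hfb y z w).trans (le_max_right _ _)) (fun w => by simp)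
    rw [h1] at h2
    simp only [mul_one, tsum_toReal_pmf, sub_self, mul_zero, tsum_zero] at h2
    linarith
  have hK : 0 < (π x).toReal * c x := by
    obtain ⟨w, hw⟩ := π.support_nonempty
    rw [hconst x w]
    exact mul_pos (ENNReal.toReal_pos hw (π.apply_ne_top w)) (by linarith [hc1 w])
  have h := tsum_dirichlet_symm hπ (f := f y z) (g := f y x)
    (C := max ((expHit P y x).toReal + (expHit P x y).toReal)
      ((expHit P y z).toReal + (expHit P z y).toReal))
    (fun w => (hfb y z w).trans (le_max_right _ _)) (fun w => (hfb y x w).trans (le_max_left _ _))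
  rw [hpair, hpair, hconst y x, hconst z x, ← mul_sub, ← mul_sub] at h
  have := mul_left_cancel₀ hK.ne' h
  simp only [hf, expHit_self, ENNReal.toReal_zero] at this
  linarith

end Cyclic

/-! ### Matthews' argument and the growth of `covMinus`. -/

section Growth

variable {M : Type u} [MeasurableSpace M] [DiscreteMeasurableSpace M]

theorem sum_inv_card_mul_expHit {P : M → PMF M} (hfin : ∀ x y, expHit P x y ≠ ∞)
    {ι : Type*} (S : Finset ι) (t : ι → M) (x : M) :
    ∑ i ∈ S, (S.card : ℝ≥0∞)⁻¹ * expHit P x (t i) =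
      ENNReal.ofReal ((∑ i ∈ S, (expHit P x (t i)).toReal) / S.card) := by
  rcases S.eq_empty_or_nonempty with rfl | hS
  · simp
  have hc : 0 < (S.card : ℝ) := by exact_mod_cast hS.card_pos
  rw [div_eq_inv_mul, ENNReal.ofReal_mul (by positivity), ENNReal.ofReal_inv_of_pos hc,
    ENNReal.ofReal_natCast, ENNReal.ofReal_sum_of_nonneg (fun _ _ => ENNReal.toReal_nonneg),
    Finset.mul_sum]
  exact Finset.sum_congr rfl fun i _ => by rw [ENNReal.ofReal_toReal (hfin _ _)]

/-- One step of Matthews' argument: removing a point `j` that has been reached from the index set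
increases the average hitting time by at least `(b - δ) / s`. -/
theorem average_le_average_erase {b δ A B h n : ℝ} (hn : 1 ≤ n) (hA : A ≤ δ) (hB : n * b ≤ B) :
    (A + B) / (n + 1) + (b - δ) * (h + (n + 1)⁻¹ - 1) ≤ B / n + (b - δ) * (h - 1) := by
  have h1 : B / n - (A + B) / (n + 1) - (b - δ) * (n + 1)⁻¹ =
      ((B - n * b) + n * (δ - A)) / (n * (n + 1)) := by
    field_simp
    ring
  have h2 : 0 ≤ ((B - n * b) + n * (δ - A)) / (n * (n + 1)) := by
    have : 0 ≤ n * (δ - A) := mul_nonneg (by linarith) (by linarith)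
    apply div_nonneg <;> nlinarith
  linarith

-- Matthews' bound for clusters, with the average hitting time as a potential. By the comparison
-- principle it suffices to start in some cluster `H j`; dropping `j` raises the average by at least
-- `(b - δ) / S.card`, and these gains sum to a harmonic number. The last cluster contributes `m`.
open Classical in
theorem average_add_le_expCov {P : M → PMF M} (hfin : ∀ x y, expHit P x y ≠ ∞)
    {ι : Type*} (H : ι → Finset M) (t : ι → M) {b δ : ℝ} (hb : δ ≤ b)
    {m : ℝ≥0∞} (hm : m ≠ ∞) (S : Finset ι)
    (hH : ∀ j ∈ S, (H j).Nonempty)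
    (hnear : ∀ j ∈ S, ∀ x ∈ H j, (expHit P x (t j)).toReal ≤ δ)
    (hfar : ∀ i ∈ S, ∀ j ∈ S, i ≠ j → ∀ x ∈ H j, b ≤ (expHit P x (t i)).toReal)
    (hcov : ∀ j ∈ S, ∀ x ∈ H j, m ≤ expCov P (H j) x) (hS : S.Nonempty) (x : M) :
    ∑ i ∈ S, (S.card : ℝ≥0∞)⁻¹ * expHit P x (t i) +
        (ENNReal.ofReal ((b - δ) * ((harmonic S.card : ℝ) - 1)) + m) ≤
      expCov P (S.biUnion H) x + ENNReal.ofReal δ := by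
  induction S using Finset.strongInduction generalizing x with
  | H S ih =>
  have hhar : ∀ n : ℕ, n ≠ 0 → 0 ≤ (harmonic n : ℝ) - 1 := by
    intro n hn
    obtain ⟨k, rfl⟩ := Nat.exists_eq_succ_of_ne_zero hn
    have : (1 : ℚ) ≤ harmonic (k + 1) := by
      rw [harmonic, Finset.sum_range_succ']
      simp only [zero_add, Nat.cast_one, inv_one, le_add_iff_nonneg_left]
      positivity
    have : (1 : ℝ) ≤ (harmonic (k + 1) : ℝ) := by exact_mod_cast this
    simpa using this
  refine sum_mul_expHit_add_le_expCov P ?_ hfin S _ ?_ t (by simp [hm]) ?_ x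
  · obtain ⟨j, hj⟩ := hS
    obtain ⟨y, hy⟩ := hH j hj
    exact ⟨y, Finset.mem_biUnion.2 ⟨j, hj, hy⟩⟩
  · rw [Finset.sum_const, nsmul_eq_mul]
    exact ENNReal.mul_inv_le_one _
  intro y hy
  obtain ⟨j, hj, hyj⟩ := Finset.mem_biUnion.1 hy
  rcases (S.erase j).eq_empty_or_nonempty with hSj | hSj
  · obtain rfl : S = {j} := by rw [← Finset.insert_erase hj, hSj]; simp
    simp only [Finset.sum_singleton, Finset.card_singleton, Nat.cast_one, inv_one, one_mul,
      Finset.singleton_biUnion, harmonic_succ, harmonic_zero, zero_add, Rat.cast_one, sub_self,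
      mul_zero, ENNReal.ofReal_zero]
    rw [add_comm]
    refine add_le_add (hcov j hj y hyj) ?_
    rw [← ENNReal.ofReal_toReal (hfin y (t j))]
    exact ENNReal.ofReal_le_ofReal (hnear j hj y hyj)
  · have hsub := Finset.erase_subset j S
    have := ih (S.erase j) (Finset.erase_ssubset hj) (fun i hi => hH i (hsub hi))
      (fun i hi => hnear i (hsub hi)) (fun i hi k hk => hfar i (hsub hi) k (hsub hk))
      (fun i hi => hcov i (hsub hi)) hSj y
    refine le_trans ?_ (this.trans (add_le_add_left
      (expCov_mono P (Finset.biUnion_subset_biUnion_of_subset_left _ hsub) y) _))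
    rw [sum_inv_card_mul_expHit hfin, sum_inv_card_mul_expHit hfin, ← add_assoc, ← add_assoc]
    have hcard : S.card = (S.erase j).card + 1 := (Finset.card_erase_add_one hj).symm
    have hc1 : 1 ≤ (S.erase j).card := hSj.card_pos
    refine add_le_add_left ?_ m
    rw [← ENNReal.ofReal_add (div_nonneg (Finset.sum_nonneg fun _ _ => ENNReal.toReal_nonneg)
      (by positivity)) (mul_nonneg (by linarith) (hhar _ (by lia))),
      ← ENNReal.ofReal_add (div_nonneg (Finset.sum_nonneg fun _ _ => ENNReal.toReal_nonneg)
      (by positivity)) (mul_nonneg (by linarith) (hhar _ (by lia)))]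
    apply ENNReal.ofReal_le_ofReal
    rw [← Finset.add_sum_erase S _ hj, hcard, harmonic_succ]
    push_cast
    refine average_le_average_erase (by exact_mod_cast hc1) (hnear j hj y hyj) ?_
    have := Finset.card_nsmul_le_sum (S.erase j) (fun i => (expHit P y (t i)).toReal) b
      fun i hi => hfar i (hsub hi) j hj (Finset.ne_of_mem_erase hi) y hyj
    simpa using this

theorem commuteDist_eq (P : M → PMF M) (x y : M) :
    commuteDist P x y = expHit P x y + expHit P y x := rfl

theorem toReal_commuteDist {P : M → PMF M} (hfin : ∀ x y, expHit P x y ≠ ∞) (x y : M) :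
    (commuteDist P x y).toReal = (expHit P x y).toReal + (expHit P y x).toReal := by
  rw [commuteDist_eq, ENNReal.toReal_add (hfin _ _) (hfin _ _)]

theorem toReal_expHit_triangle {P : M → PMF M} (hfin : ∀ x y, expHit P x y ≠ ∞) (x y z : M) :
    (expHit P x z).toReal ≤ (expHit P x y).toReal + (expHit P y z).toReal := by
  rw [← ENNReal.toReal_add (hfin _ _) (hfin _ _)]
  exact ENNReal.toReal_mono (ENNReal.add_ne_top.2 ⟨hfin _ _, hfin _ _⟩) (expHit_triangle P x y z)

/-- A set of more than `2 ^ 2 ^ n` points whose commute distances lie between `a` and `128 a`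
contains more than `2 ^ (2 ^ n - 10)` points with pairwise hitting times at least `a / 4`. -/
theorem exists_subset_expHit_ge {P : M → PMF M} (hirr : IsIrreducible P)
    (hpos : IsPositiveRecurrent P) (hrev : IsReversible P) {a : ℝ} (ha : 0 < a) {n : ℕ}
    (hn : 6 ≤ n) {T : Finset M} (hT : 2 ^ 2 ^ n < T.card)
    (hsep : ∀ x ∈ T, ∀ y ∈ T, x ≠ y → a < (commuteDist P x y).toReal)
    (hdiam : ∀ x ∈ T, ∀ y ∈ T, (commuteDist P x y).toReal ≤ 128 * a) :
    ∃ S ⊆ T, 2 ^ (2 ^ n - 10) < S.card ∧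
      ∀ x ∈ S, ∀ y ∈ S, x ≠ y → a / 4 ≤ (expHit P x y).toReal := by
  have hfin := expHit_ne_top hirr hpos
  have hTne : T.Nonempty := Finset.card_pos.1 (by lia)
  obtain ⟨o, ho⟩ := hTne
  -- The cyclic identity through the base point `o` makes the asymmetry of hitting times the
  -- increment of `φ`.
  set φ : M → ℝ := fun x => (expHit P o x).toReal - (expHit P x o).toReal with hφ
  have hφd : ∀ x y, φ y - φ x = (expHit P x y).toReal - (expHit P y x).toReal := by
    intro x y
    have := expHit_cyclic hirr hpos hrev o x y
    simp only [hφ]; linarith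
  have hφb : ∀ x ∈ T, |φ x| ≤ 128 * a := by
    intro x hx
    have h1 := hdiam o ho x hx
    rw [toReal_commuteDist hfin] at h1
    have h2 : 0 ≤ (expHit P o x).toReal := ENNReal.toReal_nonneg
    have h3 : 0 ≤ (expHit P x o).toReal := ENNReal.toReal_nonneg
    rw [abs_le]
    constructor <;> simp only [hφ] <;> linarith
  have hpow : 1024 * 2 ^ (2 ^ n - 10) = 2 ^ 2 ^ n := by
    have h64 : 2 ^ 6 ≤ 2 ^ n := Nat.pow_le_pow_right (by norm_num) hn
    rw [show 1024 = 2 ^ 10 by norm_num, ← pow_add]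
    congr 1
    lia
  -- Bins of width `a / 2`; `1024 = 2 ^ 10` of them more than cover `[-128 a, 128 a]`. Inside a bin
  -- the two hitting times differ by at most `a / 2` and sum to more than `a`, so each is at least
  -- `a / 4`.
  obtain ⟨k, -, hk⟩ := Finset.exists_lt_card_fiber_of_mul_lt_card_of_maps_to
    (s := T) (t := Finset.range 1024) (n := 2 ^ (2 ^ n - 10))
    (f := fun x => ⌊(φ x + 128 * a) / (a / 2)⌋₊) (fun x hx => by
      rw [Finset.mem_range, Nat.floor_lt' (by norm_num), div_lt_iff₀ (by linarith)]
      have := (abs_le.1 (hφb x hx)).2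
      push_cast
      linarith) (by rw [Finset.card_range, hpow]; exact hT)
  refine ⟨_, Finset.filter_subset _ _, hk, fun x hx y hy hxy => ?_⟩
  rw [Finset.mem_filter] at hx hy
  have hnn : ∀ x ∈ T, 0 ≤ (φ x + 128 * a) / (a / 2) := fun x hx =>
    div_nonneg (by linarith [(abs_le.1 (hφb x hx)).1]) (by linarith)
  have h1 : φ x - φ y ≤ a / 2 := by
    have hx2 := Nat.lt_floor_add_one ((φ x + 128 * a) / (a / 2))
    have hy2 := Nat.floor_le (hnn y hy.1)
    rw [hx.2] at hx2
    rw [hy.2] at hy2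
    have := (by linarith : (φ x + 128 * a) / (a / 2) - (φ y + 128 * a) / (a / 2) < 1)
    rw [← sub_div, div_lt_iff₀ (by linarith)] at this
    linarith
  have h2 := hsep x hx.1 y hy.1 hxy
  rw [toReal_commuteDist hfin] at h2
  linarith [hφd x y]

theorem covMinus_growth {P : M → PMF M} (hirr : IsIrreducible P)
    (hpos : IsPositiveRecurrent P) (hrev : IsReversible P) {a : ℝ} (ha : 0 < a) {n : ℕ}
    (hn : 6 ≤ n) {T : Finset M} (hT : 2 ^ 2 ^ n < T.card)
    (hsep : ∀ x ∈ T, ∀ y ∈ T, x ≠ y → a < (commuteDist P x y).toReal)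
    (hdiam : ∀ x ∈ T, ∀ y ∈ T, (commuteDist P x y).toReal ≤ 128 * a)
    {H : M → Finset M} {B : Finset M} (hmem : ∀ t ∈ T, t ∈ H t) (hHB : ∀ t ∈ T, H t ⊆ B)
    (hnear : ∀ t ∈ T, ∀ x ∈ H t, (commuteDist P x t).toReal ≤ a / 16) :
    ∃ t ∈ T, covMinus P (H t) + ENNReal.ofReal (a * 2 ^ n / 32) ≤ covMinus P B := by
  classical
  have hfin := expHit_ne_top hirr hpos
  obtain ⟨t₀, ht₀, hmin⟩ := Finset.exists_min_image T (fun t => covMinus P (H t))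
    (Finset.card_pos.1 (by lia))
  refine ⟨t₀, ht₀, ?_⟩
  by_cases hm : covMinus P (H t₀) = ∞
  · have := covMinus_mono P hfin ⟨t₀, hmem t₀ ht₀⟩ (hHB t₀ ht₀)
    rw [hm, top_le_iff] at this
    simp [this]
  obtain ⟨S, hST, hcard, hS⟩ := exists_subset_expHit_ge hirr hpos hrev ha hn hT hsep hdiam
  have hSne : S.Nonempty := Finset.card_pos.1 (by lia)
  have hd : ∀ t ∈ T, ∀ x ∈ H t, (expHit P x t).toReal ≤ a / 16 ∧
      (expHit P t x).toReal ≤ a / 16 := by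
    intro t ht x hx
    have h1 := hnear t ht x hx
    rw [toReal_commuteDist hfin] at h1
    have h2 : 0 ≤ (expHit P t x).toReal := ENNReal.toReal_nonneg
    have h3 : 0 ≤ (expHit P x t).toReal := ENNReal.toReal_nonneg
    constructor <;> linarith
  -- Here `6 ≤ n` makes the loss of 10 in the exponent negligible. Of the `3 / 2`, 1 is subtracted
  -- in the Matthews bound, and the rest yields the `a / 16` that pays for `δ`.
  have hlog : 2 ^ n / 4 + 3 / 2 ≤ (harmonic S.card : ℝ) := by
    have h1 := log_add_one_le_harmonic S.card
    have h2 : ((2 ^ n - 10 : ℕ) : ℝ) * Real.log 2 ≤ Real.log ((S.card + 1 : ℕ) : ℝ) := by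
      rw [← Real.log_pow]
      refine Real.log_le_log (by positivity) ?_
      exact_mod_cast (hcard.le.trans (Nat.le_succ _))
    have h64 : 2 ^ 6 ≤ 2 ^ n := Nat.pow_le_pow_right (by norm_num) hn
    rw [Nat.cast_sub (by lia)] at h2
    have h64' : (64 : ℝ) ≤ 2 ^ n := by exact_mod_cast h64
    push_cast at h2
    have h3 := Real.log_two_gt_d9
    have h4 : (2 ^ n - 10) * (0.69 : ℝ) ≤ (2 ^ n - 10) * Real.log 2 :=
      mul_le_mul_of_nonneg_left (by linarith) (by linarith)
    push_cast at h1
    linarith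
  refine le_iInf₂ fun x _ => ?_
  change _ ≤ expCov P B x
  -- `b = a / 4 - a / 16`: the distance to the centre is lost when starting from a general point of
  -- a cluster.
  have key := average_add_le_expCov hfin H (fun t => t) (b := 3 * a / 16) (δ := a / 16)
    (by linarith) hm S (fun t ht => ⟨t, hmem t (hST ht)⟩)
    (fun t ht x hx => (hd t (hST ht) x hx).1)
    (fun i hi j hj hij x hx => by
      have h1 := toReal_expHit_triangle hfin j x i
      have h2 := (hd j (hST hj) x hx).2
      have h3 := hS j hj i hi hij.symm
      linarith)
    (fun t ht x hx => (hmin t (hST ht)).trans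
      (covMinus_le_expCov P ⟨t, hmem t (hST ht)⟩ hfin x)) hSne x
  have hsub : expCov P (S.biUnion H) x ≤ expCov P B x :=
    expCov_mono P (Finset.biUnion_subset.2 fun t ht => hHB t (hST ht)) x
  refine (ENNReal.add_le_add_iff_right (ENNReal.ofReal_ne_top (r := a / 16))).1 ?_
  refine le_trans ?_ ((le_add_self.trans key).trans (add_le_add_left hsub _))
  rw [add_assoc, add_comm, ← ENNReal.ofReal_add (by positivity) (by positivity)]
  gcongr
  have := mul_le_mul_of_nonneg_left hlog (by linarith : 0 ≤ a / 8)
  linarith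

end Growth

/-! ### Admissible sequences from labellings, and elementary bounds on `gammaOne`. -/

section Admissible

variable {M : Type u}

theorem one_le_chainingCard (n : ℕ) : 1 ≤ chainingCard n := by
  unfold chainingCard; split_ifs
  · exact le_rfl
  · exact Nat.one_le_two_pow

theorem chainingCard_le (n : ℕ) : chainingCard n ≤ 2 ^ 2 ^ n := by
  unfold chainingCard; split_ifs
  · exact Nat.one_le_two_pow
  · exact le_rfl

theorem chainingCard_of_pos {n : ℕ} (hn : n ≠ 0) : chainingCard n = 2 ^ 2 ^ n := by
  simp [chainingCard, hn]

theorem le_diam {B : Finset M} {d : M → M → ℝ≥0∞} {x y : M} (hx : x ∈ B) (hy : y ∈ B) :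
    d x y ≤ diam B d :=
  (le_iSup₂ (f := fun y (_ : y ∈ B) => d x y) y hy).trans
    (le_iSup₂ (f := fun x (_ : x ∈ B) => ⨆ y ∈ B, d x y) x hx)

theorem diam_le {B : Finset M} {d : M → M → ℝ≥0∞} {c : ℝ≥0∞}
    (h : ∀ x ∈ B, ∀ y ∈ B, d x y ≤ c) : diam B d ≤ c :=
  iSup₂_le fun x hx => iSup₂_le fun y hy => h x hx y hy

theorem diam_mono {B C : Finset M} {d : M → M → ℝ≥0∞} (h : B ⊆ C) : diam B d ≤ diam C d :=
  diam_le fun _ hx _ hy => le_diam (h hx) (h hy)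

theorem diam_ne_top {B : Finset M} {d : M → M → ℝ≥0∞} (h : ∀ x y, d x y ≠ ∞) :
    diam B d ≠ ∞ := by
  refine ne_top_of_le_ne_top (ENNReal.sum_ne_top.2 fun x _ => ENNReal.sum_ne_top.2 fun y _ => h x y)
    (diam_le (c := ∑ x ∈ B, ∑ y ∈ B, d x y) fun x hx y hy => ?_)
  exact (Finset.single_le_sum (f := fun y => d x y) (fun _ _ => zero_le) hy).trans
    (Finset.single_le_sum (f := fun x => ∑ y ∈ B, d x y) (fun _ _ => zero_le) hx)

open Classical in
theorem card_parts_ofSetSetoid_le (r : Setoid M) (A : Finset M) {N : ℕ} (f : M → Fin N)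
    (hf : ∀ x ∈ A, ∀ y ∈ A, f x = f y → r x y) :
    (Finpartition.ofSetSetoid r A).parts.card ≤ N := by
  set Q := Finpartition.ofSetSetoid r A
  have hne : ∀ p ∈ Q.parts, ∃ x, x ∈ p := fun p hp => Q.nonempty_of_mem_parts hp
  rcases isEmpty_or_nonempty M with hM | hM
  · have : Q.parts = ∅ := Finset.eq_empty_of_forall_notMem fun p hp => hM.elim (hne p hp).choose
    simp [this]
  choose! g hg using hne
  have hgA : ∀ p ∈ Q.parts, g p ∈ A := fun p hp => Q.le hp (hg p hp)
  have := Finset.card_le_card_of_injOn (s := Q.parts) (t := (Finset.univ : Finset (Fin N)))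
    (fun p => f (g p)) (fun _ _ => Finset.mem_coe.2 (Finset.mem_univ _)) (by
      intro p hp q hq hpq
      have hpA := hgA p hp
      have hqA := hgA q hq
      have h1 : g q ∈ Q.part (g p) := (Finpartition.mem_part_ofSetSetoid_iff_rel A).2
        ⟨hpA, hqA, hf _ hpA _ hqA hpq⟩
      rw [Q.part_eq_of_mem hp (hg p hp)] at h1
      exact Q.eq_of_mem_parts hp hq h1 (hg q hq))
  simpa using this

open Classical in
theorem isAdmissible_ofSetSetoid (A : Finset M) (r : ℕ → Setoid M)
    (hanti : ∀ n x y, r (n + 1) x y → r n x y)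
    (hidx : ∀ n, ∃ N ≤ chainingCard n, ∃ f : M → Fin N,
      ∀ x ∈ A, ∀ y ∈ A, f x = f y → r n x y) :
    IsAdmissible fun n => Finpartition.ofSetSetoid (r n) A where
  refines n := by
    intro p hp
    obtain ⟨x, hx⟩ := Finpartition.nonempty_of_mem_parts _ hp
    have hxA : x ∈ A := Finpartition.le _ hp hx
    refine ⟨_, (Finpartition.part_mem (P := Finpartition.ofSetSetoid (r n) A)).2 hxA, ?_⟩
    intro y hy
    rw [← Finpartition.part_eq_of_mem _ hp hx,
      Finpartition.mem_part_ofSetSetoid_iff_rel] at hy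
    exact (Finpartition.mem_part_ofSetSetoid_iff_rel A).2 ⟨hy.1, hy.2.1, hanti n _ _ hy.2.2⟩
  card_le n := by
    obtain ⟨N, hN, f, hf⟩ := hidx n
    exact (card_parts_ofSetSetoid_le (r n) A f hf).trans hN

theorem gammaOne_le_of_setoids {A : Finset M} {d : M → M → ℝ≥0∞} (r : ℕ → Setoid M)
    (hanti : ∀ n x y, r (n + 1) x y → r n x y)
    (hidx : ∀ n, ∃ N ≤ chainingCard n, ∃ f : M → Fin N,
      ∀ x ∈ A, ∀ y ∈ A, f x = f y → r n x y) {V : ℕ → M → ℝ≥0∞}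
    (hV : ∀ n, ∀ x ∈ A, ∀ y ∈ A, ∀ z ∈ A, r n x y → r n x z → d y z ≤ V n x) :
    gammaOne A d ≤ ⨆ x ∈ A, ∑' n, 2 ^ n * V n x := by
  classical
  refine (iInf₂_le _ (isAdmissible_ofSetSetoid A r hanti hidx)).trans
    (iSup₂_mono fun x hx => ENNReal.tsum_le_tsum fun n => ?_)
  gcongr
  refine diam_le fun y hy z hz => ?_
  rw [Finpartition.mem_part_ofSetSetoid_iff_rel] at hy hz
  exact hV n x hx y hy.2.1 z hz.2.1 hy.2.2 hz.2.2

theorem exists_fin_label {κ : Type*} (A : Finset M) (g : M → κ) (S : Finset κ) {N : ℕ}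
    (hN : N ≠ 0) (hS : S.card ≤ N) (hg : ∀ x ∈ A, g x ∈ S) :
    ∃ f : M → Fin N, ∀ x ∈ A, ∀ y ∈ A, f x = f y → g x = g y := by
  classical
  have : NeZero N := ⟨hN⟩
  refine ⟨fun x => if h : g x ∈ S then Fin.castLE hS (S.equivFin ⟨g x, h⟩) else 0,
    fun x hx y hy hxy => ?_⟩
  simp only [hg x hx, hg y hy, dif_pos] at hxy
  have := S.equivFin.injective (Fin.castLE_injective hS hxy)
  exact congrArg Subtype.val this

/-- From `n = A.card` on, singletons are allowed, so only finitely many terms survive. Finiteness is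
what later permits absorbing half of `gammaOne`. -/
theorem gammaOne_ne_top {A : Finset M} {d : M → M → ℝ≥0∞} (h0 : ∀ x, d x x = 0)
    (hfin : ∀ x y, d x y ≠ ∞) : gammaOne A d ≠ ∞ := by
  classical
  let r : ℕ → Setoid M := fun n =>
    { r := fun x y => n < A.card ∨ x = y
      iseqv := ⟨fun _ => Or.inr rfl, fun h => h.imp_right Eq.symm, fun h h' => by
        rcases h with h | rfl
        · exact Or.inl h
        · exact h'⟩ }
  have hcard : ∀ n, A.card ≤ n → n ≠ 0 → A.card ≤ chainingCard n := by
    intro n hn hn0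
    rw [chainingCard_of_pos hn0]
    exact (hn.trans Nat.lt_two_pow_self.le).trans Nat.lt_two_pow_self.le
  have key := gammaOne_le_of_setoids (A := A) (d := d) r
    (fun n x y h => h.imp_left fun h => (Nat.lt_succ_self n).trans h)
    (fun n => by
      by_cases hn : n < A.card
      · exact ⟨1, one_le_chainingCard n, fun _ => 0, fun _ _ _ _ _ => Or.inl hn⟩
      · rcases A.eq_empty_or_nonempty with rfl | hA
        · exact ⟨1, one_le_chainingCard n, fun _ => 0, by simp⟩
        · have hpos := hA.card_pos
          obtain ⟨f, hf⟩ := exists_fin_label A id A hpos.ne' le_rfl fun _ hx => hx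
          exact ⟨A.card, hcard n (by lia) (by lia), f,
            fun x hx y hy h => Or.inr (hf x hx y hy h)⟩)
    (V := fun n _ => if n < A.card then diam A d else 0)
    (fun n x hx y hy z hz hxy hxz => by
      split_ifs with hn
      · exact le_diam hy hz
      · rw [← hxy.resolve_left hn, ← hxz.resolve_left hn, h0])
  have hsum : ∑' n : ℕ, (2 : ℝ≥0∞) ^ n * (if n < A.card then diam A d else 0) ≠ ∞ := by
    rw [tsum_eq_sum (s := Finset.range A.card) fun n hn => by
      rw [if_neg (by simpa using hn), mul_zero]]
    refine ENNReal.sum_ne_top.2 fun n hn => ENNReal.mul_ne_top (by simp) ?_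
    split_ifs
    · exact diam_ne_top hfin
    · simp
  exact ne_top_of_le_ne_top hsum (key.trans (iSup₂_le fun _ _ => le_rfl))

theorem diam_le_gammaOne {A : Finset M} (hA : A.Nonempty) (d : M → M → ℝ≥0∞) :
    diam A d ≤ gammaOne A d := by
  classical
  refine le_iInf₂ fun 𝒜 h𝒜 => ?_
  obtain ⟨x, hx⟩ := hA
  refine le_trans ?_ (le_iSup₂ (f := fun x (_ : x ∈ A) =>
    ∑' n : ℕ, (2 : ℝ≥0∞) ^ n * diam ((𝒜 n).part x) d) x hx)
  refine le_trans ?_ (ENNReal.le_tsum 0)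
  rw [pow_zero, one_mul]
  refine diam_mono fun y hy => ?_
  have h1 := Finset.card_le_one.1 ((h𝒜.card_le 0).trans (by simp [chainingCard]))
    _ ((𝒜 0).part_mem.2 hx) _ ((𝒜 0).part_mem.2 hy)
  rw [h1]
  exact (𝒜 0).mem_part hy

end Admissible

/-! ### Growth levels and nets at a given level. -/

section Chaining

variable {M : Type u}

/-- A growth condition for a set functional `F`: well separated pieces of radius `a / 16` around more
than `2 ^ 2 ^ n` points make `F` increase by `a * 2 ^ n / 32`. -/
def HasGrowth (A : Finset M) (d : M → M → ℝ≥0∞) (F : Finset M → ℝ≥0∞) : Prop :=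
  ∀ n, 6 ≤ n → ∀ a : ℝ≥0∞, a ≠ 0 → a ≠ ∞ → ∀ T : Finset M, 2 ^ 2 ^ n < T.card →
    (∀ x ∈ T, ∀ y ∈ T, x ≠ y → a < d x y) → (∀ x ∈ T, ∀ y ∈ T, d x y ≤ 128 * a) →
    ∀ (H : M → Finset M) (B : Finset M), B ⊆ A → (∀ t ∈ T, t ∈ H t) → (∀ t ∈ T, H t ⊆ B) →
      (∀ t ∈ T, ∀ x ∈ H t, d x t ≤ a / 16) → ∃ t ∈ T, F (H t) + a * 2 ^ n / 32 ≤ F B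

/-- The scales `4 ^ (-k) Δ(A, d)`. -/
noncomputable def scale (A : Finset M) (d : M → M → ℝ≥0∞) (k : ℕ) : ℝ≥0∞ := diam A d * 4⁻¹ ^ k

open Classical in
/-- The points of `A` at distance at most `4 ^ (-k) Δ(A, d)` from `t`. -/
noncomputable def scaleBall (A : Finset M) (d : M → M → ℝ≥0∞) (k : ℕ) (t : M) : Finset M :=
  {x ∈ A | d x t ≤ scale A d k}

theorem scale_succ (A : Finset M) (d : M → M → ℝ≥0∞) (k : ℕ) :
    4 * scale A d (k + 1) = scale A d k := by
  have h : (4 : ℝ≥0∞) * 4⁻¹ = 1 := ENNReal.mul_inv_cancel (by norm_num) (by norm_num)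
  calc 4 * (diam A d * 4⁻¹ ^ (k + 1)) = diam A d * 4⁻¹ ^ k * (4 * 4⁻¹) := by ring
    _ = _ := by rw [h, mul_one, scale]

theorem scale_zero (A : Finset M) (d : M → M → ℝ≥0∞) : scale A d 0 = diam A d := by simp [scale]

theorem scale_add_two (A : Finset M) (d : M → M → ℝ≥0∞) (k : ℕ) :
    scale A d (k + 2) = scale A d k / 16 := by
  rw [ENNReal.eq_div_iff (by norm_num) (by norm_num), ← scale_succ A d k, ← scale_succ A d (k + 1)]
  ring

theorem scale_ne_top {A : Finset M} {d : M → M → ℝ≥0∞} (hfin : ∀ x y, d x y ≠ ∞) (k : ℕ) :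
    scale A d k ≠ ∞ :=
  ENNReal.mul_ne_top (diam_ne_top hfin) (by simp)

theorem scale_ne_zero {A : Finset M} {d : M → M → ℝ≥0∞} (h : diam A d ≠ 0) (k : ℕ) :
    scale A d k ≠ 0 :=
  mul_ne_zero h (by simp)

theorem mem_scaleBall {A : Finset M} {d : M → M → ℝ≥0∞} {k : ℕ} {t x : M} :
    x ∈ scaleBall A d k t ↔ x ∈ A ∧ d x t ≤ scale A d k := by
  classical
  simp [scaleBall]

/-- At `t`, the functional increases by `2 ^ n` times the `k`-th scale around the `k`-th scale. -/
def GrowsAt (A : Finset M) (d : M → M → ℝ≥0∞) (F : Finset M → ℝ≥0∞) (n k : ℕ) (t : M) : Prop :=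
  F (scaleBall A d (k + 2) t) + scale A d k * 2 ^ n / 32 ≤ F (scaleBall A d (k - 4) t)

/-- The first scale, up to `n`, at which the functional increases around `t`. -/
noncomputable def growthLevel (A : Finset M) (d : M → M → ℝ≥0∞) (F : Finset M → ℝ≥0∞) (n : ℕ)
    (t : M) : ℕ :=
  sInf ({k | GrowsAt A d F n k t} ∪ {n})

theorem growthLevel_le (A : Finset M) (d : M → M → ℝ≥0∞) (F : Finset M → ℝ≥0∞) (n : ℕ) (t : M) :
    growthLevel A d F n t ≤ n :=
  Nat.sInf_le (Or.inr rfl)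

theorem growsAt_or_growthLevel_eq (A : Finset M) (d : M → M → ℝ≥0∞) (F : Finset M → ℝ≥0∞) (n : ℕ)
    (t : M) : GrowsAt A d F n (growthLevel A d F n t) t ∨ growthLevel A d F n t = n :=
  Nat.sInf_mem (s := {k | GrowsAt A d F n k t} ∪ {n}) ⟨n, Or.inr rfl⟩

theorem not_growsAt_of_lt {A : Finset M} {d : M → M → ℝ≥0∞} {F : Finset M → ℝ≥0∞} {n k : ℕ}
    {t : M} (h : k < growthLevel A d F n t) : ¬ GrowsAt A d F n k t :=
  fun hk => Nat.notMem_of_lt_sInf h (Or.inl hk)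

theorem exists_net_or_separated {d : M → M → ℝ≥0∞} (h0 : ∀ x, d x x = 0)
    (hsymm : ∀ x y, d x y = d y x) (B : Finset M) (ρ : ℝ≥0∞) (N : ℕ) :
    (∃ T ⊆ B, T.card ≤ N ∧ ∀ x ∈ B, ∃ t ∈ T, d x t ≤ ρ) ∨
      ∃ T ⊆ B, N < T.card ∧ ∀ x ∈ T, ∀ y ∈ T, x ≠ y → ρ < d x y := by
  classical
  obtain ⟨T, hT, hmax⟩ := Finset.exists_max_image
    (B.powerset.filter fun T => ∀ x ∈ T, ∀ y ∈ T, x ≠ y → ρ < d x y) Finset.card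
    ⟨∅, by simp⟩
  simp only [Finset.mem_filter, Finset.mem_powerset] at hT hmax
  rcases lt_or_ge N T.card with h | h
  · exact Or.inr ⟨T, hT.1, h, hT.2⟩
  refine Or.inl ⟨T, hT.1, h, fun x hx => ?_⟩
  by_contra! hcon
  have hxT : x ∉ T := fun hxT => by
    have := hcon x hxT
    rw [h0] at this
    exact not_lt_zero this
  have := hmax (insert x T) ⟨Finset.insert_subset hx hT.1, fun y hy z hz hyz => by
    rcases Finset.mem_insert.1 hy with rfl | hy' <;> rcases Finset.mem_insert.1 hz with rfl | hz'
    · exact absurd rfl hyz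
    · exact hcon z hz'
    · rw [hsymm]; exact hcon y hy'
    · exact hT.2 y hy' z hz' hyz⟩
  rw [Finset.card_insert_of_notMem hxT] at this
  lia

theorem exists_growsAt_of_separated {A : Finset M} {d : M → M → ℝ≥0∞} (h0 : ∀ x, d x x = 0)
    (htri : ∀ x y z, d x z ≤ d x y + d y z)
    (hfin : ∀ x y, d x y ≠ ∞) {F : Finset M → ℝ≥0∞}
    (hmono : ∀ B C, B.Nonempty → B ⊆ C → C ⊆ A → F B ≤ F C) (hF : HasGrowth A d F)
    (hΔ : diam A d ≠ 0) {n k : ℕ} (hn : 6 ≤ n) {T : Finset M} (hTA : T ⊆ A)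
    (hcard : 2 ^ 2 ^ n < T.card) (hsep : ∀ x ∈ T, ∀ y ∈ T, x ≠ y → scale A d k < d x y)
    (hdiam : ∀ x ∈ T, ∀ y ∈ T, d x y ≤ 128 * scale A d k) :
    ∃ t ∈ T, GrowsAt A d F n k t := by
  classical
  have hmem : ∀ t ∈ T, t ∈ scaleBall A d (k + 2) t := fun t ht =>
    mem_scaleBall.2 ⟨hTA ht, by rw [h0]; exact zero_le⟩
  have hsub : ∀ k t, scaleBall A d k t ⊆ A := fun k t x hx => (mem_scaleBall.1 hx).1
  obtain ⟨t, ht, hle⟩ := hF n hn (scale A d k) (scale_ne_zero hΔ k) (scale_ne_top hfin k) T hcard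
    hsep hdiam (scaleBall A d (k + 2)) (T.biUnion (scaleBall A d (k + 2)))
    (Finset.biUnion_subset.2 fun t _ => hsub _ t) hmem
    (fun t ht => Finset.subset_biUnion_of_mem _ ht)
    (fun t _ x hx => (mem_scaleBall.1 hx).2.trans_eq (scale_add_two A d k))
  refine ⟨t, ht, hle.trans (hmono _ _ ⟨t, Finset.mem_biUnion.2 ⟨t, ht, hmem t ht⟩⟩ ?_ (hsub _ _))⟩
  intro x hx
  obtain ⟨s, hs, hxs⟩ := Finset.mem_biUnion.1 hx
  rw [mem_scaleBall] at hxs ⊢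
  refine ⟨hxs.1, ?_⟩
  -- For `k < 4` the truncated index `k - 4` is 0 and the ball is all of `A`. Otherwise radius `129`
  -- times the `k`-th scale suffices, below `4 ^ 4 = 256`; hence the shift by 4 in `GrowsAt`.
  rcases lt_or_ge k 4 with hk | hk
  · rw [Nat.sub_eq_zero_of_le hk.le, scale_zero]
    exact le_diam hxs.1 (hTA ht)
  · obtain ⟨j, rfl⟩ : ∃ j, k = j + 4 := ⟨k - 4, by lia⟩
    rw [Nat.add_sub_cancel]
    have e1 : scale A d j = 256 * scale A d (j + 4) := by
      simp only [← scale_succ A d j, ← scale_succ A d (j + 1), ← scale_succ A d (j + 2),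
        ← scale_succ A d (j + 3)]
      ring
    calc d x t ≤ d x s + d s t := htri x s t
      _ ≤ scale A d (j + 4) + 128 * scale A d (j + 4) := by
          refine add_le_add (hxs.2.trans ?_) (hdiam s hs t ht)
          rw [scale_add_two]
          exact ENNReal.div_le_of_le_mul (le_mul_of_one_le_right zero_le (by norm_num))
      _ = 129 * scale A d (j + 4) := by ring
      _ ≤ scale A d j := by rw [e1]; gcongr; norm_num

/-- The growth condition needs a diameter of at most 128 separations. Either `k = ℓ - 1` qualifies,
or the last scale before the first failure is at most `diam D d / 32`. -/
theorem exists_scale {A D : Finset M} {d : M → M → ℝ≥0∞} (hD : D ⊆ A) {ℓ : ℕ} (hℓ : ℓ ≠ 0) :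
    ∃ k < ℓ, diam D d ≤ 128 * scale A d k ∧
      scale A d k ≤ 4 * scale A d ℓ + diam D d / 32 := by
  have h0 : diam D d ≤ 128 * scale A d 0 := by
    rw [scale_zero]
    exact (diam_mono hD).trans (le_mul_of_one_le_left zero_le (by norm_num))
  obtain ⟨ℓ, rfl⟩ := Nat.exists_eq_succ_of_ne_zero hℓ
  by_cases h : diam D d ≤ 128 * scale A d ℓ
  · exact ⟨ℓ, by lia, h, by rw [Nat.succ_eq_add_one, scale_succ]; exact le_self_add⟩
  have : ∃ k, ¬ diam D d ≤ 128 * scale A d k := ⟨ℓ, h⟩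
  classical
  obtain ⟨k, hk⟩ : ∃ k, Nat.find this = k + 1 := Nat.exists_eq_succ_of_ne_zero fun hz => by
    have := Nat.find_spec this
    rw [hz] at this
    exact this h0
  have h1 := Nat.find_spec this
  have h2 : Nat.find this ≤ ℓ := Nat.find_min' this h
  have h3 : diam D d ≤ 128 * scale A d k := not_not.1 (Nat.find_min this (by lia : k < _))
  rw [hk] at h1 h2
  refine ⟨k, by lia, h3, le_trans ?_ le_add_self⟩
  rw [ENNReal.le_div_iff_mul_le (by norm_num) (by norm_num), ← scale_succ A d k]
  exact le_trans (le_of_eq (by ring)) (not_le.1 h1).le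

/-- The label is the nearby net point at a scale `k < ℓ`. Without a small enough net there would be
a large separated set, hence growth at scale `k` around a point of level `ℓ`, against minimality of
the level. -/
theorem exists_label {A : Finset M} {d : M → M → ℝ≥0∞} (h0 : ∀ x, d x x = 0)
    (hsymm : ∀ x y, d x y = d y x) (htri : ∀ x y z, d x z ≤ d x y + d y z)
    (hfin : ∀ x y, d x y ≠ ∞) {F : Finset M → ℝ≥0∞}
    (hmono : ∀ B C, B.Nonempty → B ⊆ C → C ⊆ A → F B ≤ F C) (hF : HasGrowth A d F)
    {n : ℕ} (hn : 6 ≤ n) {D : Finset M} (hD : D ⊆ A) (ℓ : ℕ) :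
    ∃ f : M → Fin (2 ^ 2 ^ n), ∀ x ∈ D, ∀ y ∈ D, growthLevel A d F n x = ℓ →
      growthLevel A d F n y = ℓ → f x = f y → d x y ≤ 8 * scale A d ℓ + diam D d / 16 := by
  classical
  have hN : 2 ^ 2 ^ n ≠ 0 := by positivity
  have : NeZero (2 ^ 2 ^ n) := ⟨hN⟩
  by_cases htriv : ℓ = 0 ∨ diam A d = 0
  · refine ⟨fun _ => 0, fun x hx y hy _ _ _ => (le_diam (hD hx) (hD hy)).trans ?_⟩
    rcases htriv with rfl | h
    · rw [scale_zero]
      exact (le_mul_of_one_le_left zero_le (by norm_num)).trans le_self_add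
    · rw [h]; exact zero_le
  push Not at htriv
  obtain ⟨k, hk, hkD, hkρ⟩ := exists_scale (d := d) hD htriv.1
  set B := D.filter fun x => growthLevel A d F n x = ℓ with hB
  rcases exists_net_or_separated h0 hsymm B (scale A d k) (2 ^ 2 ^ n) with
    ⟨T, -, hcard, hnet⟩ | ⟨T, hTB, hcard, hsep⟩
  · choose! p hpT hp using hnet
    rcases B.eq_empty_or_nonempty with hBe | ⟨b, -⟩
    · refine ⟨fun _ => 0, fun x hx y hy hxl _ _ => ?_⟩
      have : x ∈ B := Finset.mem_filter.2 ⟨hx, hxl⟩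
      simp [hBe] at this
    obtain ⟨f, hf⟩ := exists_fin_label B p T hN hcard hpT
    refine ⟨f, fun x hx y hy hxl hyl hxy => ?_⟩
    have hxB : x ∈ B := Finset.mem_filter.2 ⟨hx, hxl⟩
    have hyB : y ∈ B := Finset.mem_filter.2 ⟨hy, hyl⟩
    calc d x y ≤ d x (p x) + d (p x) y := htri _ _ _
      _ ≤ scale A d k + scale A d k := by
          refine add_le_add (hp x hxB) ?_
          rw [hf x hxB y hyB hxy, hsymm]
          exact hp y hyB
      _ ≤ (4 * scale A d ℓ + diam D d / 32) + (4 * scale A d ℓ + diam D d / 32) :=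
          add_le_add hkρ hkρ
      _ = 8 * scale A d ℓ + (diam D d / 32 + diam D d / 32) := by ring
      _ = _ := by
          congr 1
          rw [← ENNReal.add_div, ← two_mul, show (32 : ℝ≥0∞) = 2 * 16 by norm_num]
          exact ENNReal.mul_div_mul_left _ _ (by norm_num) (by norm_num)
  · exfalso
    have hTD : T ⊆ D := hTB.trans (Finset.filter_subset _ _)
    obtain ⟨t, ht, hg⟩ := exists_growsAt_of_separated h0 htri hfin hmono hF htriv.2 hn
      (hTD.trans hD) hcard hsep (fun x hx y hy => (le_diam (hTD hx) (hTD hy)).trans hkD)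
    have hlev : growthLevel A d F n t = ℓ := (Finset.mem_filter.1 (hTB ht)).2
    exact not_growsAt_of_lt (hlev ▸ hk) hg

end Chaining

/-! ### Summation over scales and the contraction argument. -/

section ChainingSums

variable {M : Type u}

theorem tsum_ite_two_pow_mul_le (a Y : ℝ≥0∞) :
    ∑' m : ℕ, (if 2 ^ m * a ≤ Y then 2 ^ m * a else 0) ≤ 2 * Y := by
  rw [ENNReal.tsum_eq_iSup_nat]
  refine iSup_le fun N => ?_
  have key : ∑ m ∈ Finset.range N, (if 2 ^ m * a ≤ Y then 2 ^ m * a else 0) ≤ 2 * Y ∧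
      ∑ m ∈ Finset.range N, (if 2 ^ m * a ≤ Y then 2 ^ m * a else 0) ≤ 2 ^ N * a := by
    induction N with
    | zero => simp
    | succ N ih =>
      rw [Finset.sum_range_succ]
      have h2 : (2 : ℝ≥0∞) ^ N * a + 2 ^ N * a = 2 ^ (N + 1) * a := by ring
      split_ifs with h
      · have h1 := add_le_add_left ih.2 (2 ^ N * a)
        refine ⟨h1.trans ?_, h1.trans h2.le⟩
        rw [two_mul]
        exact add_le_add h h
      · rw [add_zero]
        exact ⟨ih.1, ih.2.trans (h2 ▸ le_self_add)⟩
  exact key.1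

theorem tsum_sub_shift_le {G : ℕ → ℝ≥0∞} (hG : Antitone G) :
    ∑' k, (G (k - 4) - G (k + 2)) ≤ 6 * G 0 := by
  rw [ENNReal.tsum_eq_iSup_nat]
  refine iSup_le fun K => ?_
  -- Telescoping with shift 6: the extra terms are the window of six consecutive indices still to be
  -- cancelled.
  have key : ∑ k ∈ Finset.range K, (G (k - 4) - G (k + 2)) +
      (G (K - 4) + G (K + 1 - 4) + G (K + 2 - 4) + G (K + 3 - 4) + G K + G (K + 1)) ≤ 6 * G 0 := by
    induction K with
    | zero =>
      simp only [Finset.range_zero, Finset.sum_empty, zero_add]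
      calc _ ≤ G 0 + G 0 + G 0 + G 0 + G 0 + G 0 := by
            gcongr
            all_goals exact hG (Nat.zero_le _)
        _ = _ := by ring
    | succ K ih =>
      rw [Finset.sum_range_succ]
      refine le_trans (le_of_eq ?_) ih
      have h : G (K - 4) - G (K + 2) + G (K + 2) = G (K - 4) := tsub_add_cancel_of_le (hG (by lia))
      rw [show K + 1 + 3 - 4 = K by lia, show K + 1 + 1 - 4 = K + 2 - 4 by lia,
        show K + 1 + 2 - 4 = K + 3 - 4 by lia, show K + 1 + 1 = K + 2 by lia]
      calc _ = ∑ k ∈ Finset.range K, (G (k - 4) - G (k + 2)) +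
            ((G (K - 4) - G (K + 2) + G (K + 2)) + G (K + 1 - 4) + G (K + 2 - 4) +
              G (K + 3 - 4) + G K + G (K + 1)) := by ring
        _ = _ := by rw [h]
  exact le_self_add.trans key

theorem tsum_two_pow_mul_scale (A : Finset M) (d : M → M → ℝ≥0∞) :
    ∑' m : ℕ, 2 ^ m * scale A d m = 2 * diam A d := by
  have h : ∀ m : ℕ, (2 : ℝ≥0∞) ^ m * scale A d m = diam A d * 2⁻¹ ^ m := by
    intro m
    have h2 : (2 : ℝ≥0∞) * 4⁻¹ = 2⁻¹ := by
      rw [show (4 : ℝ≥0∞) = 2 * 2 by norm_num, ENNReal.mul_inv (by norm_num) (by norm_num),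
        ← mul_assoc, ENNReal.mul_inv_cancel (by norm_num) (by norm_num), one_mul]
    rw [scale, ← h2, mul_pow]
    ring
  simp only [h]
  rw [ENNReal.tsum_mul_left, ENNReal.tsum_geometric, ENNReal.one_sub_inv_two, inv_inv, mul_comm]

/-- Levels capped at `m` contribute a convergent geometric series in `diam A d`. At the other levels
the term is at most 32 times a growth increment; for fixed `k` the sum over `m` is geometric (factor
2), and the increments telescope (factor 6), so `384 = 2 * 32 * 6`. -/
theorem tsum_scale_growthLevel_le {A : Finset M} {d : M → M → ℝ≥0∞} (h0 : ∀ x, d x x = 0)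
    {F : Finset M → ℝ≥0∞} (hmono : ∀ B C, B.Nonempty → B ⊆ C → C ⊆ A → F B ≤ F C)
    (hFA : F A ≠ ∞) {t : M} (ht : t ∈ A) :
    ∑' m, 2 ^ m * scale A d (growthLevel A d F m t) ≤ 2 * diam A d + 384 * F A := by
  classical
  set G : ℕ → ℝ≥0∞ := fun k => F (scaleBall A d k t) with hG
  have hsub : ∀ k, scaleBall A d k t ⊆ A := fun k x hx => (mem_scaleBall.1 hx).1
  have hne : ∀ k, (scaleBall A d k t).Nonempty := fun k =>
    ⟨t, mem_scaleBall.2 ⟨ht, by rw [h0]; exact zero_le⟩⟩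
  have hscale : Antitone (scale A d) := antitone_nat_of_succ_le fun k => by
    rw [← scale_succ A d k]
    exact le_mul_of_one_le_left zero_le (by norm_num)
  have hanti : Antitone G := fun j k hjk => hmono _ _ (hne k)
    (fun x hx => mem_scaleBall.2 ⟨(mem_scaleBall.1 hx).1,
      (mem_scaleBall.1 hx).2.trans (hscale hjk)⟩) (hsub j)
  have hGA : ∀ k, G k ≤ F A := fun k => hmono _ _ (hne k) (hsub k) subset_rfl
  have hgrow : ∀ m k, GrowsAt A d F m k t →
      2 ^ m * scale A d k ≤ 32 * (G (k - 4) - G (k + 2)) := by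
    intro m k h
    have h1 : scale A d k * 2 ^ m / 32 ≤ G (k - 4) - G (k + 2) :=
      ENNReal.le_sub_of_add_le_left (ne_top_of_le_ne_top hFA (hGA _)) h
    rwa [ENNReal.div_le_iff (by norm_num) (by norm_num), mul_comm, mul_comm _ (32 : ℝ≥0∞)] at h1
  have hpt : ∀ m, 2 ^ m * scale A d (growthLevel A d F m t) ≤ 2 ^ m * scale A d m +
      ∑' k, (if 2 ^ m * scale A d k ≤ 32 * (G (k - 4) - G (k + 2)) then 2 ^ m * scale A d k
        else 0) := by
    intro m
    rcases growsAt_or_growthLevel_eq A d F m t with h | h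
    · refine le_trans ?_ (le_add_self.trans (add_le_add_right (ENNReal.le_tsum
        (growthLevel A d F m t)) _))
      rw [if_pos (hgrow _ _ h)]
    · rw [h]; exact le_self_add
  calc ∑' m, 2 ^ m * scale A d (growthLevel A d F m t)
      ≤ ∑' m, (2 ^ m * scale A d m + ∑' k, (if 2 ^ m * scale A d k ≤
          32 * (G (k - 4) - G (k + 2)) then 2 ^ m * scale A d k else 0)) :=
        ENNReal.tsum_le_tsum hpt
    _ = 2 * diam A d + ∑' k, ∑' m : ℕ, (if 2 ^ m * scale A d k ≤
          32 * (G (k - 4) - G (k + 2)) then 2 ^ m * scale A d k else 0) := by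
        rw [ENNReal.tsum_add, tsum_two_pow_mul_scale, ENNReal.tsum_comm]
    _ ≤ 2 * diam A d + ∑' k, 2 * (32 * (G (k - 4) - G (k + 2))) := by
        gcongr
        exact tsum_ite_two_pow_mul_le _ _
    _ = 2 * diam A d + 64 * ∑' k, (G (k - 4) - G (k + 2)) := by
        rw [ENNReal.tsum_mul_left, ENNReal.tsum_mul_left, ← mul_assoc]; norm_num
    _ ≤ 2 * diam A d + 64 * (6 * F A) := by
        gcongr
        exact (tsum_sub_shift_le hanti).trans (by gcongr; exact hGA 0)
    _ = _ := by rw [← mul_assoc]; norm_num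

-- The label joins the part of `Q`, the level and the net point, each with at most `2 ^ 2 ^ n`
-- values; hence the exponent `3 * 2 ^ n`. The cap on `growthLevel` is what keeps the levels few.
open Classical in
theorem exists_stage_label {A : Finset M} {d : M → M → ℝ≥0∞} (h0 : ∀ x, d x x = 0)
    (hsymm : ∀ x y, d x y = d y x) (htri : ∀ x y z, d x z ≤ d x y + d y z)
    (hfin : ∀ x y, d x y ≠ ∞) {F : Finset M → ℝ≥0∞}
    (hmono : ∀ B C, B.Nonempty → B ⊆ C → C ⊆ A → F B ≤ F C) (hF : HasGrowth A d F)
    {n : ℕ} (hn : 6 ≤ n) (Q : Finpartition A) (hQ : Q.parts.card ≤ chainingCard n) :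
    ∃ f : M → Fin (2 ^ (3 * 2 ^ n)), ∀ x ∈ A, ∀ y ∈ A, ∀ z ∈ A, f x = f y → f x = f z →
      d y z ≤ 8 * scale A d (growthLevel A d F n x) + diam (Q.part x) d / 16 := by
  have hN : 2 ^ 2 ^ n ≠ 0 := by positivity
  obtain ⟨f₁, hf₁⟩ := exists_fin_label A Q.part Q.parts hN (hQ.trans (chainingCard_le n))
    (fun x hx => Q.part_mem.2 hx)
  obtain ⟨f₂, hf₂⟩ := exists_fin_label A (growthLevel A d F n) (Finset.range (n + 1)) hN
    (by rw [Finset.card_range]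
        exact (Nat.lt_two_pow_self (n := n)).trans_le (Nat.lt_two_pow_self (n := 2 ^ n)).le)
    (fun x _ => Finset.mem_range.2 (Nat.lt_succ_of_le (growthLevel_le A d F n x)))
  have hlab : ∀ (D : Finset M) (ℓ : ℕ), ∃ f : M → Fin (2 ^ 2 ^ n), D ⊆ A →
      ∀ y ∈ D, ∀ z ∈ D, growthLevel A d F n y = ℓ → growthLevel A d F n z = ℓ → f y = f z →
      d y z ≤ 8 * scale A d ℓ + diam D d / 16 := by
    intro D ℓ
    by_cases hD : D ⊆ A
    · obtain ⟨f, hf⟩ := exists_label h0 hsymm htri hfin hmono hF hn hD ℓ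
      exact ⟨f, fun _ => hf⟩
    · exact ⟨fun _ => ⟨0, Nat.pos_of_ne_zero hN⟩, fun h => absurd h hD⟩
  choose g hg using hlab
  obtain ⟨f, hf⟩ := exists_fin_label A
    (fun x => (f₁ x, f₂ x, g (Q.part x) (growthLevel A d F n x) x)) Finset.univ
    (N := 2 ^ (3 * 2 ^ n)) (by positivity)
    (by simp only [Finset.card_univ, Fintype.card_prod, Fintype.card_fin, ← pow_add]
        exact Nat.pow_le_pow_right (by norm_num) (by lia))
    (fun x _ => Finset.mem_univ _)
  refine ⟨f, fun x hx y hy z hz hxy hxz => ?_⟩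
  have e1 := hf x hx y hy hxy
  have e2 := hf x hx z hz hxz
  simp only [Prod.mk.injEq] at e1 e2
  have py := hf₁ x hx y hy e1.1
  have pz := hf₁ x hx z hz e2.1
  have ly := hf₂ x hx y hy e1.2.1
  have lz := hf₂ x hx z hz e2.2.1
  refine hg (Q.part x) _ (Q.part_subset x) y (py ▸ Q.mem_part hy) z (pz ▸ Q.mem_part hz)
    ly.symm lz.symm ?_
  have h1 := e1.2.2
  have h2 := e2.2.2
  rw [← py, ← ly] at h1
  rw [← pz, ← lz] at h2
  exact h1.symm.trans h2

theorem exists_joint_label (A : Finset M) (f : ∀ n, M → Fin (2 ^ (3 * 2 ^ n))) (n : ℕ) :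
    ∃ g : M → Fin (2 ^ (3 * 2 ^ (n + 1))), ∀ x ∈ A, ∀ y ∈ A, g x = g y →
      ∀ k ≤ n, f k x = f k y := by
  induction n with
  | zero =>
    obtain ⟨g, hg⟩ := exists_fin_label A (f 0) Finset.univ (N := 2 ^ (3 * 2 ^ (0 + 1)))
      (by positivity) (by simp) (fun x _ => Finset.mem_univ _)
    exact ⟨g, fun x hx y hy hxy k hk => by
      obtain rfl := Nat.le_zero.1 hk
      exact hg x hx y hy hxy⟩
  | succ n ih =>
    obtain ⟨g, hg⟩ := ih
    obtain ⟨g', hg'⟩ := exists_fin_label A (fun x => (g x, f (n + 1) x)) Finset.univ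
      (N := 2 ^ (3 * 2 ^ (n + 1 + 1))) (by positivity)
      (by simp only [Finset.card_univ, Fintype.card_prod, Fintype.card_fin, ← pow_add]
          exact Nat.pow_le_pow_right (by norm_num) (by rw [pow_succ 2 (n + 1)]; lia))
      (fun x _ => Finset.mem_univ _)
    refine ⟨g', fun x hx y hy hxy k hk => ?_⟩
    have := hg' x hx y hy hxy
    simp only [Prod.mk.injEq] at this
    rcases hk.lt_or_eq with hk | rfl
    · exact hg x hx y hy this.1 k (by lia)
    · exact this.2

-- The new partition at stage `n` joins the labels of stages 6 to `n - 3`: the delay 3 is affordable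
-- since `3 * 2 ^ (n - 2) ≤ 2 ^ n`. It costs a factor 8, which turns the `1 / 16` into one half and
-- the coefficient 8 of the scales into 64. Stages below 9 are trivial and cost `1 + 2 + … + 2 ^ 8 =
-- 511` diameters.
open Classical in
theorem gammaOne_le_add_half {A : Finset M} {d : M → M → ℝ≥0∞} (h0 : ∀ x, d x x = 0)
    (hsymm : ∀ x y, d x y = d y x) (htri : ∀ x y z, d x z ≤ d x y + d y z)
    (hfin : ∀ x y, d x y ≠ ∞) {F : Finset M → ℝ≥0∞}
    (hmono : ∀ B C, B.Nonempty → B ⊆ C → C ⊆ A → F B ≤ F C) (hF : HasGrowth A d F)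
    (hFA : F A ≠ ∞) (Q : ℕ → Finpartition A) (hQ : IsAdmissible Q) :
    gammaOne A d ≤ (511 * diam A d + 64 * (2 * diam A d + 384 * F A)) +
      2⁻¹ * ⨆ x ∈ A, ∑' n : ℕ, 2 ^ n * diam ((Q n).part x) d := by
  have hf : ∀ n, ∃ f : M → Fin (2 ^ (3 * 2 ^ n)), 6 ≤ n →
      ∀ x ∈ A, ∀ y ∈ A, ∀ z ∈ A, f x = f y → f x = f z →
        d y z ≤ 8 * scale A d (growthLevel A d F n x) + diam ((Q n).part x) d / 16 := by
    intro n
    by_cases hn : 6 ≤ n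
    · obtain ⟨f, hf⟩ := exists_stage_label h0 hsymm htri hfin hmono hF hn (Q n) (hQ.card_le n)
      exact ⟨f, fun _ => hf⟩
    · exact ⟨fun _ => ⟨0, by positivity⟩, fun h => absurd h hn⟩
  choose f hf using hf
  let r : ℕ → Setoid M := fun n =>
    { r := fun x y => ∀ k, 6 ≤ k → k + 3 ≤ n → f k x = f k y
      iseqv := ⟨fun _ _ _ _ => rfl, fun h k h6 hk => (h k h6 hk).symm,
        fun h h' k h6 hk => (h k h6 hk).trans (h' k h6 hk)⟩ }
  have key := gammaOne_le_of_setoids (A := A) (d := d) r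
    (fun n x y h k h6 hk => h k h6 (by lia))
    (fun n => by
      by_cases hn : n < 9
      · exact ⟨1, one_le_chainingCard n, fun _ => 0, fun _ _ _ _ _ k h6 hk => by lia⟩
      · obtain ⟨m, rfl⟩ : ∃ m, n = m + 3 := ⟨n - 3, by lia⟩
        obtain ⟨g, hg⟩ := exists_joint_label A f m
        refine ⟨_, ?_, g, fun x hx y hy hxy k _ hk => hg x hx y hy hxy k (by lia)⟩
        rw [chainingCard_of_pos (by lia)]
        exact Nat.pow_le_pow_right (by norm_num) (by rw [pow_succ, pow_add]; lia))
    (V := fun n x => if n < 9 then diam A d else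
      8 * scale A d (growthLevel A d F (n - 3) x) + diam ((Q (n - 3)).part x) d / 16)
    (fun n x hx y hy z hz hxy hxz => by
      split_ifs with hn
      · exact le_diam hy hz
      · exact hf (n - 3) (by lia) x hx y hy z hz (hxy _ (by lia) (by lia))
          (hxz _ (by lia) (by lia)))
  refine key.trans (iSup₂_le fun x hx => ?_)
  rw [← ENNReal.summable.sum_add_tsum_nat_add' (k := 9)]
  have hinit : ∑ n ∈ Finset.range 9, (2 : ℝ≥0∞) ^ n * (if n < 9 then diam A d else
      8 * scale A d (growthLevel A d F (n - 3) x) + diam ((Q (n - 3)).part x) d / 16) =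
      511 * diam A d := by
    rw [Finset.sum_congr rfl fun n hn => by rw [if_pos (Finset.mem_range.1 hn)],
      ← Finset.sum_mul]
    congr 1
    simp only [Finset.sum_range_succ, Finset.sum_range_zero]
    norm_num
  have hhalf : (8 : ℝ≥0∞) / 16 = 2⁻¹ := by
    have := ENNReal.mul_div_mul_left 1 2 (c := 8) (by norm_num) (by norm_num)
    rwa [mul_one, one_div, show (8 : ℝ≥0∞) * 2 = 16 by norm_num] at this
  have hterm : ∀ j, (2 : ℝ≥0∞) ^ (j + 9) * (if j + 9 < 9 then diam A d else
      8 * scale A d (growthLevel A d F (j + 9 - 3) x) + diam ((Q (j + 9 - 3)).part x) d / 16) =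
      64 * (2 ^ (j + 6) * scale A d (growthLevel A d F (j + 6) x)) +
        2⁻¹ * (2 ^ (j + 6) * diam ((Q (j + 6)).part x) d) := by
    intro j
    rw [if_neg (by lia), show j + 9 - 3 = j + 6 by lia, ← hhalf, show j + 9 = j + 6 + 3 by lia,
      pow_add _ (j + 6) 3, div_eq_mul_inv, div_eq_mul_inv]
    ring
  rw [hinit]
  simp only [hterm]
  rw [ENNReal.tsum_add, ENNReal.tsum_mul_left, ENNReal.tsum_mul_left, ← add_assoc]
  have hshift : ∀ g : ℕ → ℝ≥0∞, ∑' j, g (j + 6) ≤ ∑' j, g j := fun g =>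
    ENNReal.tsum_comp_le_tsum_of_injective (add_left_injective 6) g
  gcongr
  · exact (hshift fun m => 2 ^ m * scale A d (growthLevel A d F m x)).trans
      (tsum_scale_growthLevel_le h0 hmono hFA hx)
  · exact (hshift fun m => 2 ^ m * diam ((Q m).part x) d).trans
      (le_iSup₂ (f := fun x (_ : x ∈ A) => ∑' n : ℕ, 2 ^ n * diam ((Q n).part x) d) x hx)

theorem gammaOne_le_of_hasGrowth {A : Finset M} {d : M → M → ℝ≥0∞} (h0 : ∀ x, d x x = 0)
    (hsymm : ∀ x y, d x y = d y x) (htri : ∀ x y z, d x z ≤ d x y + d y z)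
    (hfin : ∀ x y, d x y ≠ ∞) {F : Finset M → ℝ≥0∞}
    (hmono : ∀ B C, B.Nonempty → B ⊆ C → C ⊆ A → F B ≤ F C) (hF : HasGrowth A d F) :
    gammaOne A d ≤ 49152 * (F A + diam A d) := by
  classical
  by_cases hFA : F A = ∞
  · rw [hFA, top_add, ENNReal.mul_top (by norm_num)]; exact le_top
  set X := 511 * diam A d + 64 * (2 * diam A d + 384 * F A) with hX
  have h1 : gammaOne A d ≤ X + 2⁻¹ * gammaOne A d := by
    conv_rhs => rw [gammaOne]
    rw [ENNReal.mul_iInf_of_ne (by norm_num) (by norm_num), ENNReal.add_iInf]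
    refine le_iInf fun Q => ?_
    rw [ENNReal.mul_iInf_of_ne (by norm_num) (by norm_num), ENNReal.add_iInf]
    exact le_iInf fun hQ => gammaOne_le_add_half h0 hsymm htri hfin hmono hF hFA Q hQ
  have hγ := gammaOne_ne_top (A := A) h0 hfin
  have h2 : 2⁻¹ * gammaOne A d ≤ X := by
    have h3 : gammaOne A d = 2⁻¹ * gammaOne A d + 2⁻¹ * gammaOne A d := by
      rw [← add_mul, ENNReal.inv_two_add_inv_two, one_mul]
    have hne : 2⁻¹ * gammaOne A d ≠ ∞ := ENNReal.mul_ne_top (by norm_num) hγ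
    exact (ENNReal.add_le_add_iff_right hne).1 (h3.symm.trans_le h1)
  calc gammaOne A d = 2 * (2⁻¹ * gammaOne A d) := by
        rw [← mul_assoc, ENNReal.mul_inv_cancel (by norm_num) (by norm_num), one_mul]
    _ ≤ 2 * X := by gcongr
    _ = 1278 * diam A d + 49152 * F A := by rw [hX]; ring
    _ ≤ 49152 * diam A d + 49152 * F A := by gcongr; norm_num
    _ = _ := by ring

end ChainingSums

/-! ### The chaining theorem applied to the commute distance. -/

section Reversible

variable {M : Type u} [MeasurableSpace M] [DiscreteMeasurableSpace M]

theorem hasGrowth_covMinus {P : M → PMF M} (hirr : IsIrreducible P)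
    (hpos : IsPositiveRecurrent P) (hrev : IsReversible P) (A : Finset M) :
    HasGrowth A (commuteDist P) (covMinus P) := by
  intro n hn a ha0 ha T hT hsep hdiam H B _ hmem hHB hnear
  have hfin := expHit_ne_top hirr hpos
  have hd : ∀ x y, commuteDist P x y ≠ ∞ := fun x y =>
    ENNReal.add_ne_top.2 ⟨hfin x y, hfin y x⟩
  have h16 : (a / 16).toReal = a.toReal / 16 := by simp
  obtain ⟨t, ht, h⟩ := covMinus_growth hirr hpos hrev (ENNReal.toReal_pos ha0 ha) hn hT
    (fun x hx y hy hxy => (ENNReal.toReal_lt_toReal ha (hd x y)).2 (hsep x hx y hy hxy))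
    (fun x hx y hy => by
      have := ENNReal.toReal_mono (ENNReal.mul_ne_top (by norm_num) ha) (hdiam x hx y hy)
      simpa using this)
    hmem hHB
    (fun t ht x hx => by
      rw [← h16]
      exact ENNReal.toReal_mono (ENNReal.div_ne_top ha (by norm_num)) (hnear t ht x hx))
  refine ⟨t, ht, le_trans (le_of_eq ?_) h⟩
  congr 1
  rw [← ENNReal.ofReal_toReal (a := a * 2 ^ n / 32)
    (ENNReal.div_ne_top (ENNReal.mul_ne_top ha (by simp)) (by norm_num))]
  simp

theorem gammaOne_commuteDist_le {P : M → PMF M} (hirr : IsIrreducible P)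
    (hpos : IsPositiveRecurrent P) (hrev : IsReversible P) (A : Finset M) :
    gammaOne A (commuteDist P) ≤ 49152 * (covMinus P A + diam A (commuteDist P)) := by
  have hfin := expHit_ne_top hirr hpos
  refine gammaOne_le_of_hasGrowth (d := commuteDist P)
    (fun x => ?_) (fun x y => ?_) (fun x y z => ?_)
    (fun x y => ENNReal.add_ne_top.2 ⟨hfin x y, hfin y x⟩)
    (fun B C hB hBC _ => covMinus_mono P hfin hB hBC) (hasGrowth_covMinus hirr hpos hrev A)
  · simp [commuteDist_eq, expHit_self]
  · exact add_comm _ _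
  · simp only [commuteDist_eq]
    calc expHit P x z + expHit P z x
        ≤ (expHit P x y + expHit P y z) + (expHit P z y + expHit P y x) :=
          add_le_add (expHit_triangle P x y z) (expHit_triangle P z y x)
      _ = _ := by ring

theorem expCov_eq_of_mem_iff (P : M → PMF M) {A B : Finset M} {x : M}
    (h : ∀ y, y ≠ x → (y ∈ A ↔ y ∈ B)) : expCov P A x = expCov P B x := by
  classical
  have : A.erase x = B.erase x := by
    ext y
    simp only [Finset.mem_erase]
    exact and_congr_right (h y)
  rw [expCov_eq, expCov_eq P B, this]

end Reversible

/-! ### The two-state example. -/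

section TwoState

variable {ε : ℝ} (hε : ε ∈ Set.Ioo (0 : ℝ) 1)

theorem step_twoStateChain (f : Fin 2 → ℝ≥0∞) (x : Fin 2) :
    step (twoStateChain ε hε) f x = ENNReal.ofReal ε * f 0 + ENNReal.ofReal (1 - ε) * f 1 := by
  rw [step_eq_tsum, tsum_fintype, Fin.sum_univ_two]
  simp [twoStateChain]

/-- The mean of the geometric distribution. -/
theorem eq_ofReal_inv_of_eq_one_add {p q : ℝ} (hp : 0 < p) (hq : 0 ≤ q) (hpq : p + q = 1)
    {h : ℕ → ℝ≥0∞} {H : ℝ≥0∞} (hH : H = ⨆ n, h n) (h0 : h 0 = 0)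
    (hs : ∀ n, h (n + 1) = 1 + ENNReal.ofReal q * h n) (heq : H = 1 + ENNReal.ofReal q * H) :
    H = ENNReal.ofReal (1 / p) := by
  have hfix : 1 + q * (1 / p) = 1 / p := by
    have : q = 1 - p := by linarith
    rw [this]; field_simp; ring
  -- The fixed-point equation alone is also solved by `∞`; the truncations rule this out.
  have hle : H ≤ ENNReal.ofReal (1 / p) := by
    rw [hH]
    refine iSup_le fun n => ?_
    induction n with
    | zero => simp [h0]
    | succ n ih =>
      rw [hs, ← hfix, ENNReal.ofReal_add zero_le_one (by positivity), ENNReal.ofReal_one,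
        ENNReal.ofReal_mul hq]
      gcongr
  have hne : H ≠ ∞ := ne_top_of_le_ne_top ENNReal.ofReal_ne_top hle
  have hr := congrArg ENNReal.toReal heq
  rw [ENNReal.toReal_add (by simp) (ENNReal.mul_ne_top (by simp) hne), ENNReal.toReal_mul,
    ENNReal.toReal_ofReal hq, ENNReal.toReal_one] at hr
  rw [← ENNReal.ofReal_toReal hne]
  congr 1
  rw [eq_div_iff hp.ne']
  have : q = 1 - p := by linarith
  rw [this] at hr
  linarith

theorem expHit_twoStateChain_one_zero :
    expHit (twoStateChain ε hε) 1 0 = ENNReal.ofReal (1 / ε) := by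
  refine eq_ofReal_inv_of_eq_one_add hε.1 (sub_nonneg.2 hε.2.le) (by ring)
    (expHit_eq_iSup _ _ _) (hitTrunc_zero _ _ _) (fun n => ?_) ?_
  · rw [hitTrunc_succ_of_ne _ _ (by simp), step_twoStateChain]
    rcases n with _ | n
    · simp [hitTrunc_zero]
    · simp [hitTrunc_succ_self]
  · conv_lhs => rw [expHit_of_ne _ (by simp), step_twoStateChain]
    simp [expHit_self]

theorem expHit_twoStateChain_zero_one :
    expHit (twoStateChain ε hε) 0 1 = ENNReal.ofReal (1 / (1 - ε)) := by
  refine eq_ofReal_inv_of_eq_one_add (sub_pos.2 hε.2) hε.1.le (by ring)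
    (expHit_eq_iSup _ _ _) (hitTrunc_zero _ _ _) (fun n => ?_) ?_
  · rw [hitTrunc_succ_of_ne _ _ (by simp), step_twoStateChain]
    rcases n with _ | n
    · simp [hitTrunc_zero]
    · simp [hitTrunc_succ_self]
  · conv_lhs => rw [expHit_of_ne _ (by simp), step_twoStateChain]
    simp [expHit_self]

theorem expHit_twoStateChain_ne_top (x y : Fin 2) : expHit (twoStateChain ε hε) x y ≠ ∞ := by
  fin_cases x <;> fin_cases y <;>
    simp [expHit_self, expHit_twoStateChain_one_zero, expHit_twoStateChain_zero_one]

theorem isIrreducible_twoStateChain : IsIrreducible (twoStateChain ε hε) := by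
  intro x y
  refine ⟨1, ?_⟩
  rw [pathLaw_succ_eq, step_twoStateChain]
  simp only [pathLaw_zero_eq]
  fin_cases y <;> simp [hε.1, hε.2]

theorem isPositiveRecurrent_twoStateChain : IsPositiveRecurrent (twoStateChain ε hε) := by
  intro x
  rw [lintegral_returnTime, step_twoStateChain]
  exact ENNReal.add_lt_top.2 ⟨by simp, ENNReal.add_lt_top.2
    ⟨ENNReal.mul_lt_top (by simp) (expHit_twoStateChain_ne_top hε _ _).lt_top,
      ENNReal.mul_lt_top (by simp) (expHit_twoStateChain_ne_top hε _ _).lt_top⟩⟩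

theorem isReversible_twoStateChain : IsReversible (twoStateChain ε hε) :=
  ⟨twoStateChain ε hε 0, fun _ _ => mul_comm _ _⟩

theorem commuteDist_twoStateChain :
    commuteDist (twoStateChain ε hε) 0 1 = ENNReal.ofReal (1 / (ε * (1 - ε))) := by
  have h1 := sub_pos.2 hε.2
  have h0 := hε.1
  rw [commuteDist_eq, expHit_twoStateChain_one_zero, expHit_twoStateChain_zero_one,
    ← ENNReal.ofReal_add (by positivity) (by positivity)]
  congr 1
  field_simp
  ring

theorem diam_twoStateChain :
    diam Finset.univ (commuteDist (twoStateChain ε hε)) =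
      ENNReal.ofReal (1 / (ε * (1 - ε))) := by
  have h10 : commuteDist (twoStateChain ε hε) 1 0 = commuteDist (twoStateChain ε hε) 0 1 :=
    add_comm _ _
  apply le_antisymm
  · refine diam_le fun x _ y _ => ?_
    fin_cases x <;> fin_cases y <;>
      simp [commuteDist_eq (x := (0 : Fin 2)) (y := 0), commuteDist_eq (x := (1 : Fin 2)) (y := 1),
        expHit_self, h10, commuteDist_twoStateChain]
  · rw [← commuteDist_twoStateChain hε]
    exact le_diam (Finset.mem_univ _) (Finset.mem_univ _)

theorem covMinus_twoStateChain :
    covMinus (twoStateChain ε hε) Finset.univ =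
      ENNReal.ofReal (min (1 / ε) (1 / (1 - ε))) := by
  have h0 : expCov (twoStateChain ε hε) Finset.univ 0 = ENNReal.ofReal (1 / (1 - ε)) := by
    rw [← expHit_twoStateChain_zero_one hε, expHit_eq_expCov]
    exact expCov_eq_of_mem_iff _ fun y hy => by fin_cases y <;> simp at hy ⊢
  have h1 : expCov (twoStateChain ε hε) Finset.univ 1 = ENNReal.ofReal (1 / ε) := by
    rw [← expHit_twoStateChain_one_zero hε, expHit_eq_expCov]
    exact expCov_eq_of_mem_iff _ fun y hy => by fin_cases y <;> simp at hy ⊢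
  rw [covMinus_eq, ENNReal.ofReal_min, ← h0, ← h1]
  apply le_antisymm
  · exact le_min (iInf₂_le _ (Finset.mem_univ _)) (iInf₂_le _ (Finset.mem_univ _))
  · refine le_iInf₂ fun x _ => ?_
    fin_cases x
    · exact min_le_right _ _
    · exact min_le_left _ _

end TwoState

end CoverTime

theorem mainTheorem3 :
    (∃ L : ℝ≥0, ∀ (M : Type u) [MeasurableSpace M] [DiscreteMeasurableSpace M] (P : M → PMF M),
      CoverTime.IsIrreducible P → CoverTime.IsPositiveRecurrent P → CoverTime.IsReversible P →
      ∀ A : Finset M, A.Nonempty →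
        CoverTime.gammaOne A (CoverTime.commuteDist P) ≤
          L * (CoverTime.covMinus P A + CoverTime.diam A (CoverTime.commuteDist P))) ∧
    (∀ (ε : ℝ) (hε : ε ∈ Set.Ioo (0 : ℝ) 1),
      CoverTime.IsIrreducible (CoverTime.twoStateChain ε hε) ∧
      CoverTime.IsPositiveRecurrent (CoverTime.twoStateChain ε hε) ∧
      CoverTime.IsReversible (CoverTime.twoStateChain ε hε) ∧
      CoverTime.diam Finset.univ (CoverTime.commuteDist (CoverTime.twoStateChain ε hε)) ≤
        CoverTime.gammaOne Finset.univ (CoverTime.commuteDist (CoverTime.twoStateChain ε hε)) ∧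
      CoverTime.diam Finset.univ (CoverTime.commuteDist (CoverTime.twoStateChain ε hε)) =
        ENNReal.ofReal (1 / (ε * (1 - ε))) ∧
      CoverTime.covMinus (CoverTime.twoStateChain ε hε) Finset.univ =
        ENNReal.ofReal (min (1 / ε) (1 / (1 - ε)))) ∧
    (∀ L : ℝ≥0, ∃ (ε : ℝ) (hε : ε ∈ Set.Ioo (0 : ℝ) 1),
      L * CoverTime.covMinus (CoverTime.twoStateChain ε hε) Finset.univ <
        CoverTime.gammaOne Finset.univ
          (CoverTime.commuteDist (CoverTime.twoStateChain ε hε))) := by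
  
  refine ⟨⟨49152, fun M _ _ P hirr hpos hrev A _ => ?_⟩, fun ε hε => ?_, fun L => ?_⟩
  · exact_mod_cast CoverTime.gammaOne_commuteDist_le hirr hpos hrev A
  · exact ⟨CoverTime.isIrreducible_twoStateChain hε, CoverTime.isPositiveRecurrent_twoStateChain hε,
      CoverTime.isReversible_twoStateChain hε,
      CoverTime.diam_le_gammaOne Finset.univ_nonempty _, CoverTime.diam_twoStateChain hε,
      CoverTime.covMinus_twoStateChain hε⟩
  · have hL : (0 : ℝ) ≤ L := L.2
    -- Any `ε` in the interval with `L * ε < 1` would do, since `covMinus` is at most `1 / (1 - ε)`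
    -- while the diameter is `1 / (ε * (1 - ε))`.
    have hε : 1 / (2 * (L : ℝ) + 2) ∈ Set.Ioo (0 : ℝ) 1 :=
      ⟨by positivity, by rw [div_lt_one (by positivity)]; linarith⟩
    refine ⟨_, hε, ?_⟩
    refine lt_of_lt_of_le ?_ (CoverTime.diam_le_gammaOne Finset.univ_nonempty _)
    rw [CoverTime.diam_twoStateChain, CoverTime.covMinus_twoStateChain,
      ← ENNReal.ofReal_coe_nnreal, ← ENNReal.ofReal_mul hL]
    set ε : ℝ := 1 / (2 * (L : ℝ) + 2) with hεdef
    have h1 : 0 < 1 - ε := sub_pos.2 hε.2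
    rw [ENNReal.ofReal_lt_ofReal_iff (one_div_pos.2 (mul_pos hε.1 h1))]
    refine (mul_le_mul_of_nonneg_left (min_le_right _ _) hL).trans_lt ?_
    have hLε : L * ε < 1 := by
      rw [hεdef, mul_one_div, div_lt_one (by positivity)]
      linarith
    rw [mul_one_div, div_lt_div_iff₀ h1 (mul_pos hε.1 h1), one_mul, ← mul_assoc]
    exact mul_lt_of_lt_one_left h1 hLε
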